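/- Let $n,d\ge 0$ be integers, $G=\mathrm{SL}(n,\mathbb C)^d$, $K=\mathrm{SU}(n)^d$, and let $T=\mathrm{ST}(n)^d\subseteq G$ be the subgroup of $d$-tuples of diagonal matrices; put $T_K=T\cap K$. Tuples of matrices are regarded as block-diagonal matrices (this fixes traces, Frobenius norms and exponentials). Thus $\mathrm{Lie}(G)$ consists of the tuples of traceless complex matrices, $\mathrm{Lie}(T)$ of the diagonal ones among them, $i\,\mathrm{Lie}(K)$ of the tuples of traceless Hermitian matrices, and $i\,\mathrm{Lie}(T_K)$ of the tuples of traceless real diagonal matrices. Let $P\subseteq G$ be the set of tuples of Hermitian positive-definite matrices of determinant one, and for $R>0$ let $$B_R=\{e^A : A\in i\,\mathrm{Lie}(K),\ \|A\|_F\le R\}\subseteq P$$ be the geodesic ball of radius $R$ about the identity in $P$; the corresponding ball in $G$ is $KB_R$. Let $\pi\colon G\to \mathrm{GL}(V)$ be a rational representation on a finite-dimensional complex vector space with a $K$-invariant Hermitian inner product $\langle\cdot,\cdot\rangle$ (linear in the second argument), for instance the tensor action $(g_1,\dots,g_d)\cdot v=(g_1\otimes\cdots\otimes g_d)v$ on $(\mathbb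 C^n)^{\otimes d}$. Write $g\cdot v=\pi(g)v$ and $\Pi(A)=\frac{d}{dt}\big|_{t=0}\pi(e^{tA})$ for $A\in\mathrm{Lie}(G)$. For $w\in V\setminus\{0\}$ the moment map $\mu_G(w)$ is the unique $M\in i\,\mathrm{Lie}(K)$ with $$\mathrm{tr}(MA)=\frac{\langle w,\Pi(A)w\rangle}{\langle w,w\rangle}\quad\text{for all } A\in i\,\mathrm{Lie}(K),$$ and $\mu_T(w)$ is defined in the same way with $i\,\mathrm{Lie}(T_K)$ in place of $i\,\mathrm{Lie}(K)$. The weight space of $\omega\in i\,\mathrm{Lie}(T_K)$ is $V_\omega=\{w : \pi(e^A)w=e^{\mathrm{tr}(A\omega)}w \text{ for all } A\in\mathrm{Lie}(T)\}$. Writing $v=\sum_\omega v_\omega$ with $v_\omega\in V_\omega$, the support of $v$ is the set of $\omega$ with $v_\omega\ne 0$; it is free if no two distinct elements of it differ by a root of $G$, i.e. by a nonzero weight of the adjoint representation. Fix $v\in V\setminus\{0\}$ and put $f_v(g)=\langle v,g\cdot v\rangle$, which is real-valued on $P$. (i) If $v$ has free support, then $\mu_T(t\cdot v)=\mu_G(t\cdot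 v)$ for all $t\in T$. (ii) Suppose that $\mu_T(t\cdot v)=\mu_G(t\cdot v)$ for all $t\in T$. Then for every $R>0$ $$\inf_{g\in B_R} f_v(g)=\inf_{g\in T\cap B_R} f_v(g),\qquad \inf_{g\in KB_R}\|g\cdot v\|^2=\inf_{g\in T\cap KB_R}\|g\cdot v\|^2 .$$ Consequently, for every $\varepsilon>0$ the noncommutative diameter bound of $f_v$ equals the commutative one: $$\inf\Big\{R>0: \inf_{B_R} f_v\le \varepsilon+\inf_{P} f_v\Big\}=\inf\Big\{R>0: \inf_{T\cap B_R} f_v\le \varepsilon+\inf_{T\cap P} f_v\Big\}.$$ -/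

import Mathlib

/-! # Moment maps, free supports and geodesic balls for representations of `SL(n)^d` -/

section DetExp

theorem hasDerivAt_det_aux {n : ℕ} (A : Matrix (Fin n) (Fin n) ℂ)
    (M : ℂ → Matrix (Fin n) (Fin n) ℂ) (h0 : M 0 = 1)
    (hM : ∀ i j, HasDerivAt (fun t => M t i j) (A i j) 0) :
    HasDerivAt (fun t => (M t).det)
      (∑ σ : Equiv.Perm (Fin n), ((Equiv.Perm.sign σ : ℤ) : ℂ) *
        ∑ i, (∏ j ∈ Finset.univ.erase i,
          (1 : Matrix (Fin n) (Fin n) ℂ) (σ j) j) • A (σ i) i) 0 := by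
  simp only [Matrix.det_apply']
  refine HasDerivAt.fun_sum fun σ _ => ?_
  refine HasDerivAt.const_mul _ ?_
  have := HasDerivAt.fun_finsetProd (u := Finset.univ) (x := (0 : ℂ))
    (f := fun i t => M t (σ i) i) (f' := fun i => A (σ i) i) (fun i _ => hM (σ i) i)
  simpa [h0] using this

open scoped Matrix.Norms.Operator in
theorem hasDerivAt_exp_entry_aux {n : ℕ} (A : Matrix (Fin n) (Fin n) ℂ) (i j : Fin n) :
    HasDerivAt (fun t : ℂ => NormedSpace.exp (t • A) i j) (A i j) 0 := by
  have h := hasDerivAt_exp_smul_const (𝕂 := ℂ) A 0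
  have h' := (LinearMap.toContinuousLinearMap
    (Matrix.entryLinearMap ℂ ℂ i j)).hasFDerivAt.comp_hasDerivAt (0 : ℂ) h
  simp only [zero_smul, NormedSpace.exp_zero, one_mul] at h'
  exact h'

/-- The exponential of a traceless complex matrix has determinant one. -/
theorem det_exp_of_trace_eq_zero {n : ℕ} (A : Matrix (Fin n) (Fin n) ℂ) (hA : A.trace = 0) :
    (NormedSpace.exp A).det = 1 := by
  have hline := hasDerivAt_det_aux A (fun t => 1 + t • A) (by simp) (fun i j => by
    have := ((hasDerivAt_id (0 : ℂ)).mul_const (A i j)).const_add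
      ((1 : Matrix (Fin n) (Fin n) ℂ) i j)
    simpa using this)
  have hlin0 : HasDerivAt (fun t : ℂ => (1 + t • A : Matrix (Fin n) (Fin n) ℂ).det) 0 0 := by
    have heq : (fun t : ℂ => (1 + t • A : Matrix (Fin n) (Fin n) ℂ).det) = fun t : ℂ =>
        1 + (Matrix.det (1 + (Polynomial.X : Polynomial ℂ) •
          A.map Polynomial.C)).divX.divX.eval t * t ^ 2 := by
      funext t
      rw [Matrix.det_one_add_smul, hA]
      ring
    rw [heq]
    have hp := (Polynomial.differentiable
      (Matrix.det (1 + (Polynomial.X : Polynomial ℂ) •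
        A.map Polynomial.C)).divX.divX).differentiableAt (x := (0 : ℂ))
    have := ((hp.hasDerivAt.mul ((hasDerivAt_id (0 : ℂ)).pow 2)).const_add (1 : ℂ))
    simpa using this
  have h0 := hasDerivAt_det_aux A (fun t => NormedSpace.exp (t • A)) (by simp)
    (hasDerivAt_exp_entry_aux A)
  rw [hline.unique hlin0] at h0
  have hmul : ∀ s t : ℂ, (NormedSpace.exp ((s + t) • A)).det
      = (NormedSpace.exp (s • A)).det * (NormedSpace.exp (t • A)).det := by
    intro s t
    rw [add_smul, Matrix.exp_add_of_commute _ _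
      (((Commute.refl A).smul_left s).smul_right t), Matrix.det_mul]
  have hall : ∀ s : ℂ, HasDerivAt (fun t : ℂ => (NormedSpace.exp (t • A)).det) 0 s := by
    intro s
    have h1 : HasDerivAt (fun t : ℂ => (NormedSpace.exp ((t - s) • A)).det) 0 s := by
      have h0' : HasDerivAt (fun t : ℂ => (NormedSpace.exp (t • A)).det) 0 (s - s) := by
        simpa using h0
      simpa using h0'.comp_sub_const s s
    have h2 := h1.const_mul ((NormedSpace.exp (s • A)).det)
    have h3 : (fun t : ℂ => (NormedSpace.exp (s • A)).det *
        (NormedSpace.exp ((t - s) • A)).det) = fun t : ℂ => (NormedSpace.exp (t • A)).det := by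
      funext t
      rw [← hmul, add_sub_cancel]
    rw [h3] at h2
    simpa using h2
  have hconst := is_const_of_deriv_eq_zero (fun s => (hall s).differentiableAt)
    (fun s => (hall s).deriv) 1 0
  simpa using hconst

end DetExp

/-- The group `G = SL(n)^d` of `d`-tuples of complex matrices of determinant one. -/
abbrev SLPow (n d : ℕ) : Type := Fin d → Matrix.SpecialLinearGroup (Fin n) ℂ

namespace SLPow

variable {n d : ℕ}

/-- The torus `T = ST(n)^d`: the tuples of diagonal matrices in `G`. -/
def torus (n d : ℕ) : Set (SLPow n d) :=
  {g | ∀ k, (g k : Matrix (Fin n) (Fin n) ℂ).IsDiag}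

/-- The maximal compact subgroup `K = SU(n)^d` of `G`. -/
def compact (n d : ℕ) : Set (SLPow n d) :=
  {g | ∀ k, (g k : Matrix (Fin n) (Fin n) ℂ) ∈ Matrix.unitaryGroup (Fin n) ℂ}

open scoped ComplexOrder in
/-- The set `P` of tuples of Hermitian positive-definite matrices in `G`. -/
def posDef (n d : ℕ) : Set (SLPow n d) :=
  {g | ∀ k, (g k : Matrix (Fin n) (Fin n) ℂ).PosDef}

/-- `Lie(G)`: the `d`-tuples of traceless complex matrices. -/
def lieG (n d : ℕ) : Submodule ℂ (Fin d → Matrix (Fin n) (Fin n) ℂ) where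
  carrier := {A | ∀ k, (A k).trace = 0}
  zero_mem' := by intro k; simp
  add_mem' := by
    intro A B hA hB k
    simp [Matrix.trace_add, hA k, hB k]
  smul_mem' := by
    intro c A hA k
    simp [Matrix.trace_smul, hA k]

/-- `Lie(T)`: the tuples of traceless diagonal matrices. -/
def lieT (n d : ℕ) : Submodule ℂ (lieG n d) where
  carrier := {A | ∀ k, (A.1 k).IsDiag}
  zero_mem' := by intro k; exact Matrix.isDiag_zero
  add_mem' := by intro A B hA hB k; exact (hA k).add (hB k)
  smul_mem' := by intro c A hA k; exact (hA k).smul c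

/-- `i Lie(K)`: the tuples of traceless Hermitian matrices. -/
noncomputable def iLieK (n d : ℕ) : Submodule ℝ (lieG n d) where
  carrier := {A | ∀ k, (A.1 k).IsHermitian}
  zero_mem' := by intro k; exact Matrix.isHermitian_zero
  add_mem' := by intro A B hA hB k; exact (hA k).add (hB k)
  smul_mem' := by
    intro c A hA k
    have h : (A.1 k).conjTranspose = A.1 k := hA k
    change (c • A.1 k).conjTranspose = c • A.1 k
    rw [Matrix.conjTranspose_smul, h, star_trivial]

/-- `i Lie(T_K)` for `T_K = K ∩ T`: the tuples of traceless real diagonal matrices. -/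
noncomputable def iLieTK (n d : ℕ) : Submodule ℝ (lieG n d) :=
  iLieK n d ⊓ (lieT n d).restrictScalars ℝ

/-- The trace form `tr(AB)`, the tuples being regarded as block-diagonal matrices. -/
noncomputable def trForm (A B : lieG n d) : ℂ := ∑ k, (A.1 k * B.1 k).trace

/-- The Frobenius norm of a tuple, regarded as a block-diagonal matrix. -/
noncomputable def frobenius (A : lieG n d) : ℝ := √(∑ k, ∑ i, ∑ j, ‖A.1 k i j‖ ^ 2)

/-- The exponential map `Lie(G) → G`, `A ↦ e^A`. -/
noncomputable def exp (A : lieG n d) : SLPow n d :=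
  fun k => ⟨NormedSpace.exp (A.1 k), det_exp_of_trace_eq_zero (A.1 k) (A.2 k)⟩

/-- The geodesic ball `B_R = {e^A : A traceless Hermitian, ‖A‖_F ≤ R}` about the identity
in `P`. -/
def ball (n d : ℕ) (R : ℝ) : Set (SLPow n d) :=
  {g | ∃ A ∈ iLieK n d, frobenius A ≤ R ∧ g = exp A}

/-- The geodesic ball `K B_R` about the identity in `G`. -/
def groupBall (n d : ℕ) (R : ℝ) : Set (SLPow n d) :=
  {g | ∃ k ∈ compact n d, ∃ p ∈ ball n d R, g = k * p}

/-- The roots of `G`: the nonzero `α ∈ i Lie(T_K)` for which there is a nonzero `B ∈ Lie(G)` with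
`[A, B] = tr(Aα) B` for all `A ∈ Lie(T)`. -/
def IsRoot (α : lieG n d) : Prop :=
  α ∈ iLieTK n d ∧ α ≠ 0 ∧ ∃ B : lieG n d, B ≠ 0 ∧
    ∀ A ∈ lieT n d, ∀ k, A.1 k * B.1 k - B.1 k * A.1 k = trForm A α • B.1 k

/-- A set of weights is free if no two distinct elements of it differ by a root. -/
def IsFree (Γ : Set (lieG n d)) : Prop :=
  ∀ ω ∈ Γ, ∀ ω' ∈ Γ, ω ≠ ω' → ¬ IsRoot (ω - ω')

section Representation

variable {V : Type*} [NormedAddCommGroup V] [InnerProductSpace ℂ V] [FiniteDimensional ℂ V]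
  (π : Representation ℂ (SLPow n d) V)

/-- `π` is rational: in some basis of `V`, the matrix entries of `π(g)` are polynomials in the
matrix entries of `g`. -/
def IsRational : Prop :=
  ∃ b : Module.Basis (Fin (Module.finrank ℂ V)) ℂ V, ∀ i j,
    ∃ p : MvPolynomial (Fin d × Fin n × Fin n) ℂ, ∀ g : SLPow n d,
      b.repr (π g (b j)) i =
        MvPolynomial.eval (fun x => (g x.1 : Matrix (Fin n) (Fin n) ℂ) x.2.1 x.2.2) p

/-- The inner product of `V` is invariant under `K`. -/
def IsKInvariant : Prop :=
  ∀ k ∈ compact n d, ∀ v w : V, inner ℂ (π k v) (π k w) = inner ℂ v w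

/-- The induced representation `Π(A) = d/dt π(e^{tA})` at `t = 0` of `Lie(G)`. -/
noncomputable def lieRep (A : lieG n d) : V →L[ℂ] V :=
  deriv (fun t : ℝ => LinearMap.toContinuousLinearMap (π (exp (t • A)))) 0

/-- `M ∈ L` satisfies `tr(MA) = ⟨v, Π(A)v⟩ / ⟨v, v⟩` for all `A ∈ L`. -/
def IsMoment (L : Submodule ℝ (lieG n d)) (v : V) (M : lieG n d) : Prop :=
  M ∈ L ∧ ∀ A ∈ L, trForm M A = inner ℂ v (lieRep π A v) / inner ℂ v v

open Classical in
/-- The element `M` of `L` determined by `IsMoment` (with value `0` if there is none; for `L` equal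
to `i Lie(K)` or `i Lie(T_K)`, `π` rational, the inner product `K`-invariant and `v ≠ 0`, there is
exactly one). -/
noncomputable def momentMap (L : Submodule ℝ (lieG n d)) (v : V) : lieG n d :=
  if h : ∃ M, IsMoment π L v M then h.choose else 0

/-- The moment map `μ_G`. -/
noncomputable def momentG (v : V) : lieG n d := momentMap π (iLieK n d) v

/-- The moment map `μ_T`. -/
noncomputable def momentT (v : V) : lieG n d := momentMap π (iLieTK n d) v

/-- The weight space `V_ω`: the vectors `w` with `π(e^A) w = e^{tr(Aω)} w` for all
`A ∈ Lie(T)`. -/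
def weightSpace (ω : lieG n d) : Submodule ℂ V where
  carrier := {w | ∀ A ∈ lieT n d, π (exp A) w = Complex.exp (trForm A ω) • w}
  zero_mem' := by intro A _; simp
  add_mem' := by
    intro v w hv hw A hA
    rw [map_add, hv A hA, hw A hA, smul_add]
  smul_mem' := by
    intro c v hv A hA
    rw [map_smul, hv A hA, smul_comm]

/-- `c` is the decomposition `v = ∑ v_ω`, `v_ω ∈ V_ω`, of `v` into weight vectors. -/
def IsWeightDecomposition (v : V) (c : lieG n d →₀ V) : Prop :=
  (∀ ω ∈ c.support, ω ∈ iLieTK n d) ∧ (∀ ω, c ω ∈ weightSpace π ω) ∧ (c.sum fun _ w => w) = v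

/-- The support of `v`: the weights `ω` for which the component `v_ω` is nonzero. -/
def weightSupport (v : V) : Set (lieG n d) :=
  {ω | ∃ c, IsWeightDecomposition π v c ∧ c ω ≠ 0}

/-- The function `f_v(g) = ⟨v, g · v⟩`, which is real-valued on `P`. -/
noncomputable def fv (v : V) (g : SLPow n d) : ℝ := (inner ℂ v (π g v) : ℂ).re

end Representation

/-- The diameter bound for `f` on `X`, where `X` is exhausted by the balls `B R`: the infimum over
`R > 0` such that `inf_{B R} f ≤ ε + inf_X f`. -/
noncomputable def diameterBound (X : Set (SLPow n d)) (B : ℝ → Set (SLPow n d))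
    (f : SLPow n d → ℝ) (ε : ℝ) : ℝ :=
  sInf {R | 0 < R ∧ sInf (f '' B R) ≤ ε + sInf (f '' X)}

end SLPow

/-!
The heart of the matter is that a minimizer of `f_v` on the flat part `T ∩ B_R` of the ball already
minimizes `f_v` on all of `B_R`. Let `e ^ H`, `H` real diagonal, be a minimizer on the flat part
(`exists_isMinOn_flat`) and let `e ^ Y ∈ B_R`. Write `e ^ Y = e ^ (H / 2) e ^ X e ^ (H / 2)` and
`w = π(e ^ (H / 2)) v`, so that `f_v(e ^ Y) = ⟨w, π(e ^ X) w⟩` and `f_v(e ^ H) = ‖w‖ ^ 2`. Convexity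
along the geodesic `s ↦ e ^ (H / 2) e ^ (s X) e ^ (H / 2)` gives
`f_v(e ^ Y) ≥ ‖w‖ ^ 2 + ⟨w, Π(X) w⟩` (`norm_sq_add_re_inner_lieRep_le`). As the two moment maps
agree at `w`, the slope `⟨w, Π(X) w⟩` depends only on the diagonal part of `X`
(`re_inner_lieRep_diagPart`), so it is the derivative of `f_v` within the flat. It is nonnegative by
the first-order condition at `H`, as soon as the diagonal part of `X` does not point out of the
ball, that is, `tr (H X) ≤ 0` when `‖H‖ = R`.

This last fact is nonpositive curvature of the space of positive-definite matrices, in the form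
`tr (H Y) ≥ tr (H ^ 2) + tr (H X)` (`Matrix.sum_sq_add_le_of_exp_eq`). It is obtained without
differentiating the matrix logarithm. An exact inequality,
`tr (sinh H (Y - X)) ≥ 2 tr (cosh H - 1)`, follows entrywise in eigenbases of `X` and `Y` from
`τ coth (τ / 2) ≥ 2`; applying it to `m` steps of size `H / m`, telescoping and letting `m → ∞`
gives the claim.

The statement about `K B_R` follows by squaring, since `‖π(k p) v‖ ^ 2 = f_v(p ^ 2)`; the one about
diameters follows because the balls exhaust `P`.

For a vector with free support, the off-diagonal part of the moment vanishes: a root vector maps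
`V_ω` into `V_(ω + α)`, and distinct weight spaces are orthogonal
(`inner_lieRep_rootVector_eq_zero`). That `v` has a weight decomposition at all comes from
simultaneous diagonalization (`exists_isWeightDecomposition`). Rationality of `π` is used through
its consequence that `Π` is complex linear with `π(e ^ A) = e ^ Π(A)` (`opRep_exp`).
-/

/-! ### Comparison of logarithms under a diagonal congruence -/

section Scalar

/-- The inequality `τ coth (τ / 2) ≥ 2` with denominators cleared, for both signs of `τ`. -/
theorem two_mul_exp_sub_one_sq_le (τ : ℝ) :
    2 * (Real.exp τ - 1) ^ 2 ≤ τ * ((Real.exp τ - 1) * (Real.exp τ + 1)) := by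
  have hd : ∀ s : ℝ, HasDerivAt (fun s : ℝ => s * (Real.exp s + 1) - 2 * (Real.exp s - 1))
      (1 + (s - 1) * Real.exp s) s := by
    intro s
    have h := ((hasDerivAt_id s).mul ((Real.hasDerivAt_exp s).add_const 1)).sub
      (((Real.hasDerivAt_exp s).sub_const 1).const_mul 2)
    refine h.congr_deriv ?_
    rw [id_eq]
    ring
  have hmono : Monotone (fun s : ℝ => s * (Real.exp s + 1) - 2 * (Real.exp s - 1)) := by
    refine monotone_of_deriv_nonneg (fun s => (hd s).differentiableAt) fun s => ?_
    rw [(hd s).deriv]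
    have h1 := Real.add_one_le_exp (-s)
    have h2 : Real.exp (-s) * Real.exp s = 1 := by rw [← Real.exp_add]; simp
    nlinarith [Real.exp_pos s]
  rcases le_total 0 τ with h | h
  · have h1 := hmono h
    have h2 := Real.one_le_exp h
    simp only [Real.exp_zero] at h1
    nlinarith
  · have h1 := hmono h
    have h2 := Real.exp_le_one_iff.mpr h
    simp only [Real.exp_zero] at h1
    nlinarith

/-- The scalar inequality `τ coth (τ / 2) ≥ 2`, `τ = y - x`, in terms of `a = e ^ τ * b`. -/
theorem two_mul_normSq_sub_le {a b : ℂ} {x y : ℝ}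
    (h : (Real.exp y : ℂ) * b = a * (Real.exp x : ℂ)) :
    2 * Complex.normSq (a - b) ≤ (star (a - b) * ((y : ℂ) * (a + b) - (a + b) * (x : ℂ))).re := by
  have ha : a = (Real.exp (y - x) : ℂ) * b := by
    have hx : (Real.exp x : ℂ) ≠ 0 := by exact_mod_cast (Real.exp_pos x).ne'
    rw [Real.exp_sub]
    push_cast at h hx ⊢
    field_simp
    rw [← h]
  have h1 : a - b = ((Real.exp (y - x) - 1 : ℝ) : ℂ) * b := by rw [ha]; push_cast; ring
  have h2 : (y : ℂ) * (a + b) - (a + b) * (x : ℂ)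
      = (((y - x) * (Real.exp (y - x) + 1) : ℝ) : ℂ) * b := by rw [ha]; push_cast; ring
  rw [h2, h1, Complex.star_def, map_mul (starRingEnd ℂ), Complex.conj_ofReal,
    Complex.normSq_mul, Complex.normSq_ofReal]
  have h3 : ((Real.exp (y - x) - 1 : ℝ) : ℂ) * (starRingEnd ℂ) b *
      ((((y - x) * (Real.exp (y - x) + 1) : ℝ) : ℂ) * b)
      = (((Real.exp (y - x) - 1) * ((y - x) * (Real.exp (y - x) + 1)) *
        Complex.normSq b : ℝ) : ℂ) := by
    push_cast
    rw [Complex.normSq_eq_conj_mul_self]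
    ring
  rw [h3, Complex.ofReal_re]
  nlinarith [two_mul_exp_sub_one_sq_le (y - x), Complex.normSq_nonneg b]

theorem sq_le_exp_half_sub_exp_neg_half_sq (h : ℝ) :
    h ^ 2 ≤ (Real.exp (h / 2) - Real.exp (-(h / 2))) ^ 2 := by
  have h1 : Real.exp (h / 2) - Real.exp (-(h / 2)) = 2 * Real.sinh (h / 2) := by
    rw [Real.sinh_eq]; ring
  rw [h1]
  rcases le_total 0 h with hh | hh
  · have := Real.self_le_sinh_iff.mpr (by linarith : 0 ≤ h / 2)
    nlinarith
  · have := Real.sinh_le_self_iff.mpr (by linarith : h / 2 ≤ 0)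
    nlinarith

end Scalar

namespace Matrix

variable {n : Type*} [Fintype n] [DecidableEq n]

theorem exp_unitary_conj_diagonal {U : Matrix n n ℂ} (hU : U ∈ unitaryGroup n ℂ) (x : n → ℝ) :
    NormedSpace.exp (U * diagonal (fun i => (x i : ℂ)) * star U) =
      U * diagonal (fun i => (Real.exp (x i) : ℂ)) * star U := by
  have hinv : U⁻¹ = star U := inv_eq_left_inv (Unitary.star_mul_self_of_mem hU)
  have hu : IsUnit U := (Unitary.toUnits ⟨U, hU⟩).isUnit
  rw [← hinv, exp_conj _ _ hu, exp_diagonal]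
  congr 3
  funext i
  rw [Pi.coe_exp]
  simp [Complex.exp_eq_exp_ℂ]

theorem exp_diagonal_ofReal (x : n → ℝ) :
    NormedSpace.exp (diagonal (fun i => (x i : ℂ))) =
      diagonal (fun i => (Real.exp (x i) : ℂ)) := by
  simpa using exp_unitary_conj_diagonal (one_mem (unitaryGroup n ℂ)) x

theorem IsHermitian.exists_unitary_diagonal {X : Matrix n n ℂ} (hX : X.IsHermitian) :
    ∃ U ∈ unitaryGroup n ℂ, ∃ x : n → ℝ, X = U * diagonal (fun i => (x i : ℂ)) * star U :=
  ⟨hX.eigenvectorUnitary, hX.eigenvectorUnitary.2, hX.eigenvalues, by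
    simpa [Unitary.conjStarAlgAut_apply, Function.comp_def] using hX.spectral_theorem⟩

open scoped ComplexOrder in
theorem IsHermitian.posDef_exp {X : Matrix n n ℂ} (hX : X.IsHermitian) :
    (NormedSpace.exp X).PosDef := by
  obtain ⟨U, hU, x, rfl⟩ := hX.exists_unitary_diagonal
  rw [exp_unitary_conj_diagonal hU]
  have hd : (diagonal (fun i => (Real.exp (x i) : ℂ))).PosDef :=
    PosDef.diagonal fun i => by exact_mod_cast Real.exp_pos (x i)
  exact hd.mul_mul_conjTranspose_same
    (vecMul_injective_of_isUnit (Unitary.toUnits ⟨U, hU⟩).isUnit)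

open scoped ComplexOrder in
theorem PosDef.exists_isHermitian_exp_eq {p : Matrix n n ℂ} (hp : p.PosDef) :
    ∃ Y : Matrix n n ℂ, Y.IsHermitian ∧ NormedSpace.exp Y = p ∧ (p.det = 1 → Y.trace = 0) := by
  obtain ⟨U, hU, x, hx⟩ : ∃ U ∈ unitaryGroup n ℂ, ∃ x : n → ℝ,
      p = U * diagonal (fun i => (Real.exp (x i) : ℂ)) * star U := by
    refine ⟨hp.1.eigenvectorUnitary, hp.1.eigenvectorUnitary.2,
      fun i => Real.log (hp.1.eigenvalues i), ?_⟩
    have h := hp.1.spectral_theorem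
    simp only [Real.exp_log (hp.eigenvalues_pos _)]
    simpa [Unitary.conjStarAlgAut_apply, Function.comp_def] using h
  have hUU : star U * U = 1 := Unitary.star_mul_self_of_mem hU
  refine ⟨U * diagonal (fun i => (x i : ℂ)) * star U, ?_, ?_, fun hdet => ?_⟩
  · refine isHermitian_mul_mul_conjTranspose U (isHermitian_diagonal_of_self_adjoint _ ?_)
    ext i
    simp
  · rw [exp_unitary_conj_diagonal hU, hx]
  · have hu : IsUnit U := (Unitary.toUnits ⟨U, hU⟩).isUnit
    have h1 : p.det = ((Real.exp (∑ i, x i) : ℝ) : ℂ) := by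
      rw [hx, ← inv_eq_left_inv hUU, det_conj hu, det_diagonal,
        Real.exp_sum, Complex.ofReal_prod]
    rw [trace_mul_comm, ← mul_assoc, hUU, one_mul, trace_diagonal]
    rw [h1] at hdet
    have h2 : Real.exp (∑ i, x i) = 1 := by exact_mod_cast hdet
    rw [Real.exp_eq_one_iff] at h2
    exact_mod_cast h2

/-- One step of the comparison of logarithms: if `e ^ Y = e ^ (H / 2) e ^ X e ^ (H / 2)` for a real
diagonal matrix `H`, then `tr (sinh H (Y - X)) ≥ 2 tr (cosh H - 1) ≥ tr (H ^ 2)`. In eigenbases of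
`Y` and `X`, with `a` and `b` the matrices of `e ^ (H / 2)` and `e ^ (-H / 2)`, the hypothesis says
`e ^ (y j) * b j i = a j i * e ^ (x i)`, and the first inequality is a sum of scalar inequalities. -/
theorem two_mul_sum_sq_le_of_exp_eq {X Y : Matrix n n ℂ} (hX : X.IsHermitian)
    (hY : Y.IsHermitian) (h : n → ℝ)
    (hexp : NormedSpace.exp Y = diagonal (fun i => (Real.exp (h i / 2) : ℂ)) *
      NormedSpace.exp X * diagonal (fun i => (Real.exp (h i / 2) : ℂ))) :
    2 * ∑ i, h i ^ 2 ≤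
      ∑ i, (Real.exp (h i) - Real.exp (-h i)) * ((Y i i).re - (X i i).re) := by
  obtain ⟨U, hU, x, hx⟩ := hX.exists_unitary_diagonal
  obtain ⟨W, hW, y, hy⟩ := hY.exists_unitary_diagonal
  have hU1 : star U * U = 1 := Unitary.star_mul_self_of_mem hU
  have hU2 : U * star U = 1 := Unitary.mul_star_self_of_mem hU
  have hW1 : star W * W = 1 := Unitary.star_mul_self_of_mem hW
  have hW2 : W * star W = 1 := Unitary.mul_star_self_of_mem hW
  have hexpX := exp_unitary_conj_diagonal hU x
  have hexpY := exp_unitary_conj_diagonal hW y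
  rw [← hx] at hexpX
  rw [← hy] at hexpY
  set m : n → ℝ := fun i => Real.exp (h i / 2) with hm
  set m' : n → ℝ := fun i => Real.exp (-(h i / 2)) with hm'
  set M : Matrix n n ℂ := diagonal (fun i => (m i : ℂ)) with hM
  set M' : Matrix n n ℂ := diagonal (fun i => (m' i : ℂ)) with hM'
  have hMM : M * M' = 1 := by
    rw [hM, hM', diagonal_mul_diagonal, ← diagonal_one]
    congr 1
    funext i
    rw [← Complex.ofReal_mul, hm, hm', ← Real.exp_add]
    simp
  set a := star W * M * U with ha
  set b := star W * M' * U with hb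
  have hab : diagonal (fun i => (Real.exp (y i) : ℂ)) * b
      = a * diagonal (fun i => (Real.exp (x i) : ℂ)) := by
    have e1 : diagonal (fun i => (Real.exp (y i) : ℂ)) * star W
        = star W * NormedSpace.exp Y := by
      rw [hexpY, ← mul_assoc, ← mul_assoc, hW1, one_mul]
    have e2 : NormedSpace.exp X * U = U * diagonal (fun i => (Real.exp (x i) : ℂ)) := by
      rw [hexpX, mul_assoc, hU1, mul_one]
    calc diagonal (fun i => (Real.exp (y i) : ℂ)) * b
        = star W * NormedSpace.exp Y * M' * U := by
          rw [hb, ← mul_assoc, ← mul_assoc, e1]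
      _ = star W * M * (NormedSpace.exp X * (M * M') * U) := by
          rw [hexp]; simp only [mul_assoc]
      _ = a * diagonal (fun i => (Real.exp (x i) : ℂ)) := by
          rw [hMM, mul_one, e2, ha]; simp only [mul_assoc]
  have hpt : ∀ j i, 2 * Complex.normSq ((a - b) j i) ≤ (star ((a - b) j i) *
      ((diagonal (fun i => (y i : ℂ)) * (a + b) -
        (a + b) * diagonal (fun i => (x i : ℂ))) j i)).re := by
    intro j i
    have h0 := congrFun (congrFun hab j) i
    rw [diagonal_mul, mul_diagonal] at h0
    have := two_mul_normSq_sub_le h0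
    rwa [sub_apply, sub_apply, diagonal_mul, mul_diagonal, add_apply]
  have hminus : a - b = star W * (M - M') * U := by
    rw [ha, hb, mul_sub, sub_mul]
  have hplus : a + b = star W * (M + M') * U := by
    rw [ha, hb, mul_add, add_mul]
  have hMstar : star (M - M') = M - M' := by
    rw [hM, hM', diagonal_sub, star_eq_conjTranspose, diagonal_conjTranspose]
    congr 1
    funext i
    simp
  have hstar : star (a - b) = star U * (M - M') * W := by
    rw [hminus, star_mul, star_mul, star_star, hMstar, mul_assoc]
  have key : ∀ Z : Matrix n n ℂ, ∑ j, ∑ i, star ((a - b) j i) * Z j i =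
      (star (a - b) * Z).trace := by
    intro Z
    rw [Finset.sum_comm]
    simp [trace, mul_apply, star_eq_conjTranspose, conjTranspose_apply]
  have hsum1 : (star (a - b) * (a - b)).trace = ((∑ i, (m i - m' i) ^ 2 : ℝ) : ℂ) := by
    rw [hstar, hminus]
    have : star U * (M - M') * W * (star W * (M - M') * U)
        = star U * ((M - M') * (M - M')) * U := by
      calc _ = star U * (M - M') * (W * star W) * (M - M') * U := by simp only [mul_assoc]
        _ = _ := by rw [hW2]; simp only [mul_assoc, one_mul]
    rw [this, trace_mul_comm, ← mul_assoc, hU2, one_mul, hM, hM', diagonal_sub,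
      diagonal_mul_diagonal, trace_diagonal]
    push_cast
    exact Finset.sum_congr rfl fun i _ => by ring
  have hsum2 : (star (a - b) * (diagonal (fun i => (y i : ℂ)) * (a + b) -
      (a + b) * diagonal (fun i => (x i : ℂ)))).trace =
      ∑ i, ((m i - m' i) * (m i + m' i) : ℝ) * (Y i i - X i i) := by
    have e1 : diagonal (fun i => (y i : ℂ)) * star W = star W * Y := by
      rw [hy, ← mul_assoc, ← mul_assoc, hW1, one_mul]
    have e2 : U * diagonal (fun i => (x i : ℂ)) = X * U := by
      rw [hx, mul_assoc, hU1, mul_one]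
    have e3 : diagonal (fun i => (y i : ℂ)) * (a + b) - (a + b) * diagonal (fun i => (x i : ℂ))
        = star W * (Y * (M + M') - (M + M') * X) * U := by
      rw [hplus, mul_assoc _ U, e2, ← mul_assoc, ← mul_assoc, e1]
      simp only [mul_sub, sub_mul, mul_assoc]
    have e4 : star U * (M - M') * W * (star W * (Y * (M + M') - (M + M') * X) * U)
        = star U * ((M - M') * (Y * (M + M') - (M + M') * X)) * U := by
      calc _ = star U * (M - M') * (W * star W) * (Y * (M + M') - (M + M') * X) * U := by
            simp only [mul_assoc]
        _ = _ := by rw [hW2]; simp only [mul_assoc, one_mul]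
    rw [e3, hstar, e4, trace_mul_comm, ← mul_assoc, hU2, one_mul, hM, hM', diagonal_sub,
      diagonal_add]
    simp only [trace, diag_apply, diagonal_mul, mul_diagonal, sub_apply]
    refine Finset.sum_congr rfl fun i _ => ?_
    push_cast
    ring
  have hfin : 2 * ∑ i, (m i - m' i) ^ 2 ≤
      ∑ i, ((m i - m' i) * (m i + m' i)) * ((Y i i).re - (X i i).re) := by
    have s1 : ∑ j, ∑ i, Complex.normSq ((a - b) j i) = ∑ i, (m i - m' i) ^ 2 := by
      have := key (a - b)
      rw [hsum1] at this
      have h3 := congrArg Complex.re this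
      rw [Complex.ofReal_re] at h3
      rw [← h3]
      simp only [Complex.re_sum]
      refine Finset.sum_congr rfl fun j _ => Finset.sum_congr rfl fun i _ => ?_
      rw [Complex.star_def, ← Complex.normSq_eq_conj_mul_self, Complex.ofReal_re]
    have s2 := congrArg Complex.re (key (diagonal (fun i => (y i : ℂ)) * (a + b) -
      (a + b) * diagonal (fun i => (x i : ℂ))))
    rw [hsum2] at s2
    simp only [Complex.re_sum, Complex.re_ofReal_mul, Complex.sub_re] at s2
    rw [← s1, ← s2, Finset.mul_sum]
    refine Finset.sum_le_sum fun j _ => ?_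
    rw [Finset.mul_sum]
    exact Finset.sum_le_sum fun i _ => hpt j i
  calc 2 * ∑ i, h i ^ 2 ≤ 2 * ∑ i, (m i - m' i) ^ 2 := by
        refine mul_le_mul_of_nonneg_left ?_ zero_le_two
        exact Finset.sum_le_sum fun i _ => sq_le_exp_half_sub_exp_neg_half_sq (h i)
    _ ≤ _ := hfin
    _ = _ := by
        refine Finset.sum_congr rfl fun i _ => ?_
        congr 1
        have e1 : m i * m i = Real.exp (h i) := by
          rw [hm, ← Real.exp_add]; congr 1; ring
        have e2 : m' i * m' i = Real.exp (-h i) := by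
          rw [hm', ← Real.exp_add]; congr 1; ring
        rw [← e1, ← e2]; ring

open scoped ComplexOrder in
theorem IsHermitian.exists_exp_eq_diagonal_congr {X : Matrix n n ℂ} (hX : X.IsHermitian)
    (h : n → ℝ) : ∃ Z : Matrix n n ℂ, Z.IsHermitian ∧
      NormedSpace.exp Z = diagonal (fun i => (Real.exp (h i) : ℂ)) *
        NormedSpace.exp X * diagonal (fun i => (Real.exp (h i) : ℂ)) ∧
      ((NormedSpace.exp X).det = 1 → ∑ i, h i = 0 → Z.trace = 0) := by
  set D : Matrix n n ℂ := diagonal (fun i => (Real.exp (h i) : ℂ)) with hD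
  have hDs : Dᴴ = D := by
    rw [hD, diagonal_conjTranspose]
    congr 1
    funext i
    exact Complex.conj_ofReal _
  have hu : IsUnit D := by
    rw [hD, isUnit_diagonal, Pi.isUnit_iff]
    intro i
    exact isUnit_iff_ne_zero.mpr (by exact_mod_cast (Real.exp_pos _).ne')
  have hp : (D * NormedSpace.exp X * D).PosDef := by
    have := hX.posDef_exp.mul_mul_conjTranspose_same (vecMul_injective_of_isUnit hu)
    rwa [hDs] at this
  obtain ⟨Z, hZ, hexp, htr⟩ := hp.exists_isHermitian_exp_eq
  refine ⟨Z, hZ, hexp, fun h0 h1 => htr ?_⟩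
  rw [det_mul, det_mul, hD, det_diagonal, ← Complex.ofReal_prod, ← Real.exp_sum, h1, h0]
  simp

/-- The one-step comparison along `m + 1` steps with the same `H`: the intermediate points are
positive definite, so they have logarithms, whose differences telescope. -/
theorem two_mul_sum_sq_le_of_exp_eq_iterate (m : ℕ) (h : n → ℝ) {X Y : Matrix n n ℂ}
    (hX : X.IsHermitian) (hY : Y.IsHermitian)
    (hexp : NormedSpace.exp Y = diagonal (fun i => (Real.exp ((m + 1) * (h i / 2)) : ℂ)) *
      NormedSpace.exp X * diagonal (fun i => (Real.exp ((m + 1) * (h i / 2)) : ℂ))) :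
    2 * (m + 1) * ∑ i, h i ^ 2 ≤
      ∑ i, (Real.exp (h i) - Real.exp (-h i)) * ((Y i i).re - (X i i).re) := by
  induction m generalizing Y with
  | zero => simpa using two_mul_sum_sq_le_of_exp_eq hX hY h (by simpa using hexp)
  | succ m ih =>
    obtain ⟨Z, hZ, hZe, -⟩ := hX.exists_exp_eq_diagonal_congr fun i => (m + 1) * (h i / 2)
    have h1 := ih hZ hZe
    have h2 := two_mul_sum_sq_le_of_exp_eq hZ hY h (by
      rw [hexp, hZe, ← mul_assoc, ← mul_assoc, diagonal_mul_diagonal, mul_assoc _ (diagonal _),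
        diagonal_mul_diagonal]
      simp only [← Complex.ofReal_mul, ← Real.exp_add]
      push_cast
      congr 3
      · funext i; ring_nf
      · funext i; ring_nf)
    have h3 : ∑ i, (Real.exp (h i) - Real.exp (-h i)) * ((Y i i).re - (X i i).re)
        = ∑ i, (Real.exp (h i) - Real.exp (-h i)) * ((Z i i).re - (X i i).re)
          + ∑ i, (Real.exp (h i) - Real.exp (-h i)) * ((Y i i).re - (Z i i).re) := by
      rw [← Finset.sum_add_distrib]
      exact Finset.sum_congr rfl fun i _ => by ring
    push_cast
    linarith

theorem _root_.Real.tendsto_nat_mul_exp_sub_exp_neg (h : ℝ) :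
    Filter.Tendsto (fun m : ℕ => ((m : ℝ) + 1) *
      (Real.exp (h / (m + 1)) - Real.exp (-(h / (m + 1))))) Filter.atTop (nhds (2 * h)) := by
  have hd : HasDerivAt (fun t : ℝ => Real.exp (h * t) - Real.exp (-(h * t))) (2 * h) 0 := by
    have h1 := ((hasDerivAt_id (0 : ℝ)).const_mul h)
    have := h1.exp.sub h1.fun_neg.exp
    refine this.congr_deriv ?_
    rw [id_eq, mul_zero, neg_zero, Real.exp_zero]
    ring
  have h1 := hd.tendsto_slope_zero
  have h2 : Filter.Tendsto (fun m : ℕ => 1 / ((m : ℝ) + 1)) Filter.atTop (nhdsWithin 0 {0}ᶜ) :=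
    tendsto_nhdsWithin_iff.mpr ⟨tendsto_one_div_add_atTop_nhds_zero_nat,
      Filter.Eventually.of_forall fun m => by
        simp only [Set.mem_compl_iff, Set.mem_singleton_iff]; positivity⟩
  refine (h1.comp h2).congr fun m => ?_
  simp [div_eq_mul_inv]

/-- If `e ^ Y = e ^ (H / 2) e ^ X e ^ (H / 2)` for a real diagonal matrix `H`, then
`tr (H Y) ≥ tr (H ^ 2) + tr (H X)`. This is the comparison of the geodesic triangle with vertices
`1`, `e ^ H`, `e ^ Y` in the nonpositively curved space of positive-definite matrices with a
Euclidean one. -/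
theorem sum_sq_add_le_of_exp_eq (h : n → ℝ) {X Y : Matrix n n ℂ}
    (hX : X.IsHermitian) (hY : Y.IsHermitian)
    (hexp : NormedSpace.exp Y = diagonal (fun i => (Real.exp (h i / 2) : ℂ)) *
      NormedSpace.exp X * diagonal (fun i => (Real.exp (h i / 2) : ℂ))) :
    ∑ i, h i ^ 2 + ∑ i, h i * (X i i).re ≤ ∑ i, h i * (Y i i).re := by
  have hm : ∀ m : ℕ, 2 * ∑ i, h i ^ 2 ≤ ∑ i, (((m : ℝ) + 1) *
      (Real.exp (h i / (m + 1)) - Real.exp (-(h i / (m + 1))))) * ((Y i i).re - (X i i).re) := by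
    intro m
    have hpos : (0 : ℝ) < (m : ℝ) + 1 := by positivity
    have := two_mul_sum_sq_le_of_exp_eq_iterate m (fun i => h i / (m + 1)) hX hY (by
      rw [hexp]
      have : ∀ i, ((m : ℝ) + 1) * (h i / (m + 1) / 2) = h i / 2 := fun i => by field_simp
      simp only [this])
    have h2 := mul_le_mul_of_nonneg_left this hpos.le
    calc 2 * ∑ i, h i ^ 2
        = ((m : ℝ) + 1) * (2 * (m + 1) * ∑ i, (h i / (m + 1)) ^ 2) := by
          simp only [div_pow, ← Finset.sum_div]
          field_simp
      _ ≤ _ := h2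
      _ = _ := by
          rw [Finset.mul_sum]
          exact Finset.sum_congr rfl fun i _ => by ring
  have hlim : Filter.Tendsto (fun m : ℕ => ∑ i, (((m : ℝ) + 1) *
      (Real.exp (h i / (m + 1)) - Real.exp (-(h i / (m + 1))))) * ((Y i i).re - (X i i).re))
      Filter.atTop (nhds (∑ i, (2 * h i) * ((Y i i).re - (X i i).re))) :=
    tendsto_finsetSum _ fun i _ => (Real.tendsto_nat_mul_exp_sub_exp_neg (h i)).mul_const _
  have := ge_of_tendsto' hlim hm
  simp only [mul_sub, Finset.sum_sub_distrib, mul_assoc, ← Finset.mul_sum] at this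
  linarith

end Matrix

/-! ### The infinitesimal representation -/

/-- A polynomial is differentiable, with a complex linear derivative; the derivative is taken along
arbitrary curves through a given point. -/
theorem MvPolynomial.exists_linearMap_hasDerivAt_eval {σ : Type*} (p : MvPolynomial σ ℂ)
    (x₀ : σ → ℂ) : ∃ ℓ : (σ → ℂ) →ₗ[ℂ] ℂ, ∀ (c : ℝ → σ → ℂ) (c' : σ → ℂ), c 0 = x₀ →
      (∀ s, HasDerivAt (fun t => c t s) (c' s) 0) →
        HasDerivAt (fun t => MvPolynomial.eval (c t) p) (ℓ c') 0 := by
  induction p using MvPolynomial.induction_on with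
  | C a =>
    refine ⟨0, fun c c' _ _ => ?_⟩
    simpa using hasDerivAt_const (0 : ℝ) a
  | add p q hp hq =>
    obtain ⟨ℓ, hℓ⟩ := hp
    obtain ⟨ℓ', hℓ'⟩ := hq
    refine ⟨ℓ + ℓ', fun c c' h0 hc => ?_⟩
    simpa using (hℓ c c' h0 hc).fun_add (hℓ' c c' h0 hc)
  | mul_X p i hp =>
    obtain ⟨ℓ, hℓ⟩ := hp
    refine ⟨x₀ i • ℓ + MvPolynomial.eval x₀ p • LinearMap.proj i, fun c c' h0 hc => ?_⟩
    have := (hℓ c c' h0 hc).fun_mul (hc i)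
    simp only [map_mul, MvPolynomial.eval_X]
    refine this.congr_deriv ?_
    simp [h0]
    ring

theorem ContinuousLinearMap.exp_apply_of_apply_eq_smul {V : Type*} [NormedAddCommGroup V]
    [NormedSpace ℂ V] [CompleteSpace V] {T : V →L[ℂ] V} {x : V} {c : ℂ} (h : T x = c • x) :
    NormedSpace.exp T x = Complex.exp c • x := by
  have hpow : ∀ m : ℕ, (T ^ m) x = c ^ m • x := by
    intro m
    induction m with
    | zero => simp
    | succ m ih => rw [pow_succ', mul_apply_eq_comp, ih, map_smul, h, smul_smul,
        pow_succ]
  have h1 := (NormedSpace.exp_series_hasSum_exp' (𝕂 := ℂ) T).mapL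
    (ContinuousLinearMap.apply ℂ V x)
  have h2 := (NormedSpace.exp_series_hasSum_exp' (𝕂 := ℂ) c).smul_const x
  rw [Complex.exp_eq_exp_ℂ]
  refine h1.unique ?_
  convert h2 using 2 with m
  simp [hpow, smul_smul]

namespace SLPow

variable {n d : ℕ}

theorem exp_add_of_commute (A B : lieG n d) (h : ∀ k, Commute (A.1 k) (B.1 k)) :
    exp (A + B) = exp A * exp B := by
  funext k
  apply Subtype.ext
  exact Matrix.exp_add_of_commute _ _ (h k)

@[simp] theorem exp_zero : exp (0 : lieG n d) = 1 := by
  funext k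
  apply Subtype.ext
  exact NormedSpace.exp_zero

theorem exp_add_smul (A : lieG n d) (s t : ℝ) :
    exp ((s + t) • A) = exp (s • A) * exp (t • A) := by
  rw [add_smul]
  refine exp_add_of_commute _ _ fun k => ?_
  exact ((Commute.refl (A.1 k)).smul_left s).smul_right t

theorem hasDerivAt_exp_smul_entry (A : lieG n d) (k : Fin d) (i j : Fin n) :
    HasDerivAt (fun t : ℝ => (exp (t • A) k : Matrix (Fin n) (Fin n) ℂ) i j) (A.1 k i j) 0 := by
  have h := (hasDerivAt_exp_entry_aux (A.1 k) i j)
  have h' : HasDerivAt (fun t : ℂ => NormedSpace.exp (t • A.1 k) i j) (A.1 k i j)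
      (((0 : ℝ) : ℂ)) := by simpa using h
  exact h'.comp_ofReal

/-- Conjugation commutes with the exponential map, written without inverses. -/
theorem mul_exp_eq_exp_mul (g : SLPow n d) {B B' : lieG n d}
    (h : ∀ k, (g k : Matrix (Fin n) (Fin n) ℂ) * B.1 k = B'.1 k * g k) (t : ℝ) :
    g * exp (t • B) = exp (t • B') * g := by
  funext k
  apply Subtype.ext
  have hu : IsUnit (g k : Matrix (Fin n) (Fin n) ℂ) := by
    rw [Matrix.isUnit_iff_isUnit_det, (g k).2]
    exact isUnit_one
  have hdet : IsUnit (g k : Matrix (Fin n) (Fin n) ℂ).det := (Matrix.isUnit_iff_isUnit_det _).1 hu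
  have h1 : t • B'.1 k = (g k : Matrix (Fin n) (Fin n) ℂ) * (t • B.1 k) *
      (g k : Matrix (Fin n) (Fin n) ℂ)⁻¹ := by
    rw [mul_smul_comm, h k, smul_mul_assoc, Matrix.mul_nonsing_inv_cancel_right _ _ hdet]
  change (g k : Matrix (Fin n) (Fin n) ℂ) * NormedSpace.exp (t • B.1 k)
    = NormedSpace.exp (t • B'.1 k) * (g k : Matrix (Fin n) (Fin n) ℂ)
  rw [h1, Matrix.exp_conj _ _ hu, Matrix.nonsing_inv_mul_cancel_right _ _ hdet]

section Representation

variable {V : Type*} [NormedAddCommGroup V] [InnerProductSpace ℂ V] [FiniteDimensional ℂ V]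
  {π : Representation ℂ (SLPow n d) V}

/-- The representation as a homomorphism into the bounded operators. -/
noncomputable def opRep (π : Representation ℂ (SLPow n d) V) : SLPow n d →* (V →L[ℂ] V) where
  toFun g := LinearMap.toContinuousLinearMap (π g)
  map_one' := by ext x; simp
  map_mul' g h := by ext x; simp

@[simp] theorem opRep_apply (g : SLPow n d) (x : V) : opRep π g x = π g x := rfl

theorem exists_opRep_eq_eval (hrat : IsRational π) :
    ∃ (p : Fin (Module.finrank ℂ V) → Fin (Module.finrank ℂ V) →
        MvPolynomial (Fin d × Fin n × Fin n) ℂ)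
      (L : (Fin (Module.finrank ℂ V) → Fin (Module.finrank ℂ V) → ℂ) →ₗ[ℂ] (V →L[ℂ] V)),
      ∀ g : SLPow n d, opRep π g = L (fun i j => MvPolynomial.eval
        (fun x => (g x.1 : Matrix (Fin n) (Fin n) ℂ) x.2.1 x.2.2) (p i j)) := by
  obtain ⟨b, hb⟩ := hrat
  choose p hp using hb
  refine ⟨p, (LinearMap.toContinuousLinearMap : (V →ₗ[ℂ] V) ≃ₗ[ℂ] (V →L[ℂ] V)).toLinearMap ∘ₗ
      (Matrix.toLin b b).toLinearMap ∘ₗ (Matrix.ofLinearEquiv ℂ).toLinearMap, fun g => ?_⟩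
  have : (Matrix.ofLinearEquiv ℂ (fun i j => MvPolynomial.eval
      (fun x => (g x.1 : Matrix (Fin n) (Fin n) ℂ) x.2.1 x.2.2) (p i j)))
        = LinearMap.toMatrix b b (π g) := by
    ext i j
    rw [LinearMap.toMatrix_apply, hp]
    rfl
  simp only [LinearMap.comp_apply, LinearEquiv.coe_coe]
  rw [this, Matrix.toLin_toMatrix]
  rfl

theorem continuous_opRep_comp (hrat : IsRational π) {X : Type*} [TopologicalSpace X]
    {g : X → SLPow n d}
    (hg : ∀ k i j, Continuous fun x => (g x k : Matrix (Fin n) (Fin n) ℂ) i j) :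
    Continuous fun x => opRep π (g x) := by
  obtain ⟨p, L, hL⟩ := exists_opRep_eq_eval hrat
  simp only [hL]
  refine (LinearMap.toContinuousLinearMap L).continuous.comp ?_
  refine continuous_pi fun i => continuous_pi fun j => ?_
  exact (MvPolynomial.continuous_eval (p i j)).comp (continuous_pi fun x => hg x.1 x.2.1 x.2.2)

theorem exists_linearMap_hasDerivAt (hrat : IsRational π) :
    ∃ D : lieG n d →ₗ[ℂ] (V →L[ℂ] V), ∀ A : lieG n d,
      HasDerivAt (fun t : ℝ => opRep π (exp (t • A))) (D A) 0 := by
  obtain ⟨p, L, hL⟩ := exists_opRep_eq_eval hrat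
  have hE := fun i j => (p i j).exists_linearMap_hasDerivAt_eval
    (fun x => (1 : Matrix (Fin n) (Fin n) ℂ) x.2.1 x.2.2)
  choose ℓ hℓ using hE
  let ent : lieG n d →ₗ[ℂ] (Fin d × Fin n × Fin n → ℂ) :=
    { toFun := fun A x => A.1 x.1 x.2.1 x.2.2
      map_add' := fun A B => rfl
      map_smul' := fun c A => rfl }
  refine ⟨L ∘ₗ LinearMap.pi (fun i => LinearMap.pi fun j => ℓ i j ∘ₗ ent), fun A => ?_⟩
  have h1 : HasDerivAt (fun t : ℝ => fun i j => MvPolynomial.eval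
      (fun x : Fin d × Fin n × Fin n =>
        (exp (t • A) x.1 : Matrix (Fin n) (Fin n) ℂ) x.2.1 x.2.2) (p i j))
      (fun i j => ℓ i j (ent A)) 0 := by
    refine hasDerivAt_pi.2 fun i => hasDerivAt_pi.2 fun j => ?_
    refine hℓ i j (fun t x => (exp (t • A) x.1 : Matrix (Fin n) (Fin n) ℂ) x.2.1 x.2.2) _ ?_ ?_
    · simp
    · exact fun x => hasDerivAt_exp_smul_entry A x.1 x.2.1 x.2.2
  have h2 := ((LinearMap.toContinuousLinearMap L).restrictScalars ℝ).hasFDerivAt.comp_hasDerivAt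
    (0 : ℝ) h1
  simp only [hL]
  exact h2

theorem hasDerivAt_opRep_exp (hrat : IsRational π) (A : lieG n d) :
    HasDerivAt (fun t : ℝ => opRep π (exp (t • A))) (lieRep π A) 0 := by
  obtain ⟨D, hD⟩ := exists_linearMap_hasDerivAt hrat
  exact (hD A).differentiableAt.hasDerivAt

theorem lieRep_add (hrat : IsRational π) (A B : lieG n d) :
    lieRep π (A + B) = lieRep π A + lieRep π B := by
  obtain ⟨D, hD⟩ := exists_linearMap_hasDerivAt hrat
  have h : ∀ A, lieRep π A = D A := fun A => (hD A).deriv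
  simp [h]

theorem lieRep_smul (hrat : IsRational π) (c : ℂ) (A : lieG n d) :
    lieRep π (c • A) = c • lieRep π A := by
  obtain ⟨D, hD⟩ := exists_linearMap_hasDerivAt hrat
  have h : ∀ A, lieRep π A = D A := fun A => (hD A).deriv
  simp [h]

theorem lieRep_real_smul (hrat : IsRational π) (c : ℝ) (A : lieG n d) :
    lieRep π (c • A) = (c : ℂ) • lieRep π A :=
  lieRep_smul hrat (c : ℂ) A

/-- Both `t ↦ π(e ^ (t A))` and `t ↦ e ^ (t Π(A))` are one-parameter groups with derivative `Π(A)`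
at `0`, so they coincide. -/
theorem opRep_exp (hrat : IsRational π) (A : lieG n d) :
    opRep π (exp A) = NormedSpace.exp (lieRep π A) := by
  have : CompleteSpace V := FiniteDimensional.complete ℂ V
  set U : ℝ → (V →L[ℂ] V) := fun t => opRep π (exp (t • A)) with hU
  have hUd : ∀ s, HasDerivAt U (U s * lieRep π A) s := by
    intro s
    have h0 : HasDerivAt U (lieRep π A) (s - s) := by
      rw [sub_self]; exact hasDerivAt_opRep_exp hrat A
    have h1 := (h0.comp_sub_const s s).const_mul (U s)
    refine h1.congr_of_eventuallyEq (Filter.Eventually.of_forall fun t => ?_)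
    simp only [hU, ← map_mul, ← exp_add_smul, add_sub_cancel]
  have hEd : ∀ s : ℝ, HasDerivAt (fun t : ℝ => NormedSpace.exp ((-t) • lieRep π A))
      (-(lieRep π A * NormedSpace.exp ((-s) • lieRep π A))) s := by
    intro s
    have h := (hasDerivAt_exp_smul_const' (𝕂 := ℝ) (lieRep π A) (-s)).scomp s (hasDerivAt_neg s)
    rw [neg_one_smul] at h
    exact h
  have hconst := is_const_of_deriv_eq_zero
    (f := fun t : ℝ => U t * NormedSpace.exp ((-t) • lieRep π A))
    (fun s => ((hUd s).mul (hEd s)).differentiableAt) (fun s => by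
      refine ((hUd s).mul (hEd s)).deriv.trans ?_
      rw [mul_neg, mul_assoc, add_neg_cancel]) 1 0
  simp only [hU, one_smul, zero_smul, neg_zero, exp_zero, map_one, NormedSpace.exp_zero,
    mul_one] at hconst
  have hinv : NormedSpace.exp ((-1 : ℝ) • lieRep π A) * NormedSpace.exp (lieRep π A) = 1 := by
    let _ : NormedAlgebra ℚ (V →L[ℂ] V) := NormedAlgebra.restrictScalars ℚ ℂ _
    rw [neg_one_smul, ← NormedSpace.exp_add_of_commute (Commute.neg_left (Commute.refl _)),
      neg_add_cancel, NormedSpace.exp_zero]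
  calc opRep π (exp A) = opRep π (exp A) *
        (NormedSpace.exp ((-1 : ℝ) • lieRep π A) * NormedSpace.exp (lieRep π A)) := by
          rw [hinv, mul_one]
    _ = _ := by rw [← mul_assoc, hconst, one_mul]

/-- Equivariance of the infinitesimal representation: `π(g) Π(B) = Π(g B g⁻¹) π(g)`. -/
theorem opRep_mul_lieRep (hrat : IsRational π) (g : SLPow n d) {B B' : lieG n d}
    (h : ∀ k, (g k : Matrix (Fin n) (Fin n) ℂ) * B.1 k = B'.1 k * g k) :
    opRep π g * lieRep π B = lieRep π B' * opRep π g := by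
  have h1 := (hasDerivAt_opRep_exp hrat B).const_mul (opRep π g)
  have h2 := (hasDerivAt_opRep_exp hrat B').mul_const (opRep π g)
  simp only [← map_mul, mul_exp_eq_exp_mul g h] at h1 h2
  exact h1.unique h2

theorem commute_lieRep (hrat : IsRational π) {A B : lieG n d}
    (h : ∀ k, Commute (A.1 k) (B.1 k)) : Commute (lieRep π A) (lieRep π B) := by
  have h1 := (hasDerivAt_opRep_exp hrat A).mul_const (lieRep π B)
  have h2 := (hasDerivAt_opRep_exp hrat A).const_mul (lieRep π B)
  have h3 : ∀ t : ℝ, opRep π (exp (t • A)) * lieRep π B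
      = lieRep π B * opRep π (exp (t • A)) := fun t =>
    opRep_mul_lieRep hrat _ fun k => (((h k).smul_left t).exp_left)
  simp only [h3] at h1
  exact h1.unique h2

theorem exp_I_smul_mem_compact {A : lieG n d} (hA : A ∈ iLieK n d) (t : ℝ) :
    exp (t • (Complex.I • A)) ∈ compact n d := by
  intro k
  have hk : (A.1 k).conjTranspose = A.1 k := hA k
  set B : Matrix (Fin n) (Fin n) ℂ := t • (Complex.I • A.1 k) with hB
  have hBs : B.conjTranspose = -B := by
    rw [hB, Matrix.conjTranspose_smul, Matrix.conjTranspose_smul, hk]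
    simp
  change NormedSpace.exp B ∈ _
  rw [Matrix.mem_unitaryGroup_iff', Matrix.star_eq_conjTranspose, ← Matrix.exp_conjTranspose, hBs,
    ← Matrix.exp_add_of_commute _ _ (Commute.neg_left (Commute.refl B)), neg_add_cancel,
    NormedSpace.exp_zero]

/-- `Π(A)` is self-adjoint for `A ∈ i Lie(K)`: as `e ^ (i t A) ∈ K`, the derivative
`Π(i A) = i Π(A)` of a curve of unitary operators is skew-adjoint. -/
theorem inner_lieRep_left (hrat : IsRational π) (hinv : IsKInvariant π) {A : lieG n d}
    (hA : A ∈ iLieK n d) (x y : V) :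
    inner ℂ (lieRep π A x) y = inner ℂ x (lieRep π A y) := by
  have hd := hasDerivAt_opRep_exp hrat (Complex.I • A)
  have hx : ∀ z : V, HasDerivAt (fun t : ℝ => opRep π (exp (t • (Complex.I • A))) z)
      (lieRep π (Complex.I • A) z) 0 := fun z =>
    ((ContinuousLinearMap.apply ℂ V z).restrictScalars ℝ).hasFDerivAt.comp_hasDerivAt (0 : ℝ) hd
  have h1 := (hx x).inner ℂ (hx y)
  simp only [opRep_apply, hinv _ (exp_I_smul_mem_compact hA _)] at h1
  have h2 := h1.unique (hasDerivAt_const (0 : ℝ) (inner ℂ x y))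
  simp only [zero_smul, exp_zero, map_one, Module.End.one_apply, lieRep_smul hrat,
    smul_apply, inner_smul_left, inner_smul_right, Complex.conj_I] at h2
  have h3 : Complex.I * (inner ℂ x (lieRep π A y) - inner ℂ (lieRep π A x) y) = 0 := by
    linear_combination h2
  have h4 := (mul_eq_zero.1 h3).resolve_left Complex.I_ne_zero
  exact (sub_eq_zero.1 h4).symm

theorem inner_rep_exp_left (hrat : IsRational π) (hinv : IsKInvariant π) {A : lieG n d}
    (hA : A ∈ iLieK n d) (x y : V) :
    inner ℂ (π (exp A) x) y = inner ℂ x (π (exp A) y) := by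
  have : CompleteSpace V := FiniteDimensional.complete ℂ V
  have hs : IsSelfAdjoint (lieRep π A) :=
    ContinuousLinearMap.isSelfAdjoint_iff_isSymmetric.2 fun x y =>
      inner_lieRep_left hrat hinv hA x y
  have hs' : IsSelfAdjoint (opRep π (exp A)) := by
    rw [opRep_exp hrat]
    exact hs.exp
  exact ContinuousLinearMap.isSelfAdjoint_iff_isSymmetric.1 hs' x y

theorem hasDerivAt_inner_rep_exp (hrat : IsRational π) (A : lieG n d) (w : V) :
    HasDerivAt (fun t : ℝ => (inner ℂ w (π (exp (t • A)) w) : ℂ).re)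
      (inner ℂ w (lieRep π A w) : ℂ).re 0 := by
  have hd := hasDerivAt_opRep_exp hrat A
  have h1 := ((ContinuousLinearMap.apply ℂ V w).restrictScalars ℝ).hasFDerivAt.comp_hasDerivAt
    (0 : ℝ) hd
  exact (Complex.reCLM.hasFDerivAt.comp_hasDerivAt (0 : ℝ)
    ((hasDerivAt_const (0 : ℝ) w).inner ℂ h1)).congr_deriv (by simp)

end Representation

end SLPow

/-! ### The trace form and diagonal parts -/

namespace SLPow

variable {n d : ℕ}

theorem iLieTK_le_iLieK : iLieTK n d ≤ iLieK n d := inf_le_left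

theorem trForm_add_left (A B C : lieG n d) : trForm (A + B) C = trForm A C + trForm B C := by
  simp [trForm, add_mul, Finset.sum_add_distrib]

theorem trForm_smul_left (c : ℂ) (A B : lieG n d) : trForm (c • A) B = c * trForm A B := by
  simp [trForm, Finset.mul_sum]

theorem trForm_comm (A B : lieG n d) : trForm A B = trForm B A :=
  Finset.sum_congr rfl fun _ _ => Matrix.trace_mul_comm _ _

theorem trForm_add_right (A B C : lieG n d) : trForm A (B + C) = trForm A B + trForm A C := by
  rw [trForm_comm, trForm_add_left, trForm_comm B, trForm_comm C]

theorem trForm_smul_right (c : ℂ) (A B : lieG n d) : trForm A (c • B) = c * trForm A B := by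
  rw [trForm_comm, trForm_smul_left, trForm_comm B]

theorem trForm_real_smul_left (c : ℝ) (A B : lieG n d) :
    trForm (c • A) B = (c : ℂ) * trForm A B := trForm_smul_left (c : ℂ) A B

theorem trForm_real_smul_right (c : ℝ) (A B : lieG n d) :
    trForm A (c • B) = (c : ℂ) * trForm A B := trForm_smul_right (c : ℂ) A B

theorem trForm_sub_right (A B C : lieG n d) : trForm A (B - C) = trForm A B - trForm A C := by
  simp [trForm, mul_sub]

theorem trForm_sub_left (A B C : lieG n d) : trForm (A - B) C = trForm A C - trForm B C := by
  simp [trForm, sub_mul]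

theorem trForm_eq_ofReal_re {A B : lieG n d} (hA : A ∈ iLieK n d) (hB : B ∈ iLieK n d) :
    trForm A B = ((trForm A B).re : ℂ) := by
  refine (Complex.conj_eq_iff_re.1 ?_).symm
  conv_rhs => rw [trForm_comm]
  simp only [trForm, map_sum]
  refine Finset.sum_congr rfl fun k _ => ?_
  have h1 : (A.1 k).conjTranspose = A.1 k := hA k
  have h2 : (B.1 k).conjTranspose = B.1 k := hB k
  rw [← Complex.star_def, ← Matrix.trace_conjTranspose, Matrix.conjTranspose_mul, h1, h2]

theorem frobenius_nonneg (A : lieG n d) : 0 ≤ frobenius A := Real.sqrt_nonneg _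

theorem frobenius_sq (A : lieG n d) : frobenius A ^ 2 = ∑ k, ∑ i, ∑ j, ‖A.1 k i j‖ ^ 2 :=
  Real.sq_sqrt (by positivity)

theorem trForm_self {A : lieG n d} (hA : A ∈ iLieK n d) :
    trForm A A = ((frobenius A ^ 2 : ℝ) : ℂ) := by
  rw [frobenius_sq, trForm]
  push_cast
  refine Finset.sum_congr rfl fun k _ => ?_
  simp only [Matrix.trace, Matrix.diag_apply, Matrix.mul_apply]
  refine Finset.sum_congr rfl fun i _ => Finset.sum_congr rfl fun j _ => ?_
  rw [← (hA k).apply j i, Complex.star_def, Complex.mul_conj, Complex.normSq_eq_norm_sq,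
    Complex.ofReal_pow]

theorem eq_zero_of_frobenius_eq_zero {A : lieG n d} (h : frobenius A = 0) : A = 0 := by
  have h1 : ∑ k, ∑ i, ∑ j, ‖A.1 k i j‖ ^ 2 = 0 := by rw [← frobenius_sq, h]; simp
  apply Subtype.ext
  funext k
  ext i j
  rw [Finset.sum_eq_zero_iff_of_nonneg fun _ _ => by positivity] at h1
  have h2 := h1 k (Finset.mem_univ _)
  rw [Finset.sum_eq_zero_iff_of_nonneg fun _ _ => by positivity] at h2
  have h3 := h2 i (Finset.mem_univ _)
  rw [Finset.sum_eq_zero_iff_of_nonneg fun _ _ => by positivity] at h3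
  simpa using h3 j (Finset.mem_univ _)

theorem frobenius_real_smul (c : ℝ) (A : lieG n d) : frobenius (c • A) = |c| * frobenius A := by
  have h : ∀ k i j, (c • A).1 k i j = (c : ℂ) * A.1 k i j := fun _ _ _ => rfl
  rw [frobenius, frobenius, ← Real.sqrt_sq_eq_abs, ← Real.sqrt_mul (sq_nonneg c)]
  congr 1
  simp only [h, Finset.mul_sum, norm_mul, mul_pow, Complex.norm_real, Real.norm_eq_abs, sq_abs]

/-- The tuple of real diagonal matrices with the given traceless diagonals. -/
noncomputable def diagTuple (a : Fin d → Fin n → ℝ) (ha : ∀ k, ∑ i, a k i = 0) : lieG n d :=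
  ⟨fun k => Matrix.diagonal fun i => (a k i : ℂ), fun k => by
    rw [Matrix.trace_diagonal, ← Complex.ofReal_sum, ha, Complex.ofReal_zero]⟩

theorem diagTuple_mem (a : Fin d → Fin n → ℝ) (ha : ∀ k, ∑ i, a k i = 0) :
    diagTuple a ha ∈ iLieTK n d := by
  refine ⟨fun k => ?_, fun k => Matrix.isDiag_diagonal _⟩
  refine Matrix.isHermitian_diagonal_of_self_adjoint _ ?_
  ext i
  simp

theorem sum_re_diag_eq_zero (A : lieG n d) (k : Fin d) : ∑ i, (A.1 k i i).re = 0 := by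
  have := congrArg Complex.re (A.2 k)
  simpa [Matrix.trace] using this

theorem sum_im_diag_eq_zero (A : lieG n d) (k : Fin d) : ∑ i, (A.1 k i i).im = 0 := by
  have := congrArg Complex.im (A.2 k)
  simpa [Matrix.trace] using this

/-- The tuple of the real parts of the diagonals of a tuple of matrices. -/
noncomputable def diagPart (A : lieG n d) : lieG n d :=
  diagTuple (fun k i => (A.1 k i i).re) (sum_re_diag_eq_zero A)

theorem diagPart_mem (A : lieG n d) : diagPart A ∈ iLieTK n d := diagTuple_mem _ _

theorem coe_re_apply_diag {A : lieG n d} (hA : A ∈ iLieK n d) (k : Fin d) (i : Fin n) :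
    ((A.1 k i i).re : ℂ) = A.1 k i i :=
  Complex.conj_eq_iff_re.1 ((hA k).apply i i)

theorem eq_diagonal_of_mem_iLieTK {A : lieG n d} (hA : A ∈ iLieTK n d) (k : Fin d) :
    A.1 k = Matrix.diagonal fun i => ((A.1 k i i).re : ℂ) := by
  simp only [coe_re_apply_diag hA.1]
  exact ((hA.2 k).diagonal_diag).symm

theorem exists_eq_add_I_smul_of_mem_lieT {A : lieG n d} (hA : A ∈ lieT n d) :
    ∃ B ∈ iLieTK n d, ∃ C ∈ iLieTK n d, A = B + Complex.I • C := by
  refine ⟨diagPart A, diagPart_mem A, diagTuple (fun k i => (A.1 k i i).im)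
    (sum_im_diag_eq_zero A), diagTuple_mem _ _, ?_⟩
  apply Subtype.ext
  funext k
  change A.1 k = Matrix.diagonal (fun i => ((A.1 k i i).re : ℂ)) +
    Complex.I • Matrix.diagonal (fun i => ((A.1 k i i).im : ℂ))
  conv_lhs => rw [← (hA k).diagonal_diag]
  rw [← Matrix.diagonal_smul, Matrix.diagonal_add]
  congr 1
  funext i
  simp only [Matrix.diag_apply, Pi.smul_apply, smul_eq_mul]
  conv_lhs => rw [← Complex.re_add_im (A.1 k i i)]
  ring

theorem trForm_eq_sum_of_mem_lieT {M : lieG n d} (hM : M ∈ lieT n d) (A : lieG n d) :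
    trForm M A = ∑ k, ∑ i, M.1 k i i * A.1 k i i := by
  refine Finset.sum_congr rfl fun k _ => ?_
  rw [← (hM k).diagonal_diag]
  simp [Matrix.trace, Matrix.diagonal_mul]

theorem trForm_diagPart {M A : lieG n d} (hM : M ∈ lieT n d) (hA : A ∈ iLieK n d) :
    trForm M (diagPart A) = trForm M A := by
  rw [trForm_eq_sum_of_mem_lieT hM, trForm_eq_sum_of_mem_lieT hM]
  refine Finset.sum_congr rfl fun k _ => Finset.sum_congr rfl fun i _ => ?_
  rw [← coe_re_apply_diag hA k i]
  simp [diagPart, diagTuple]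

/-- The root vector `E_ij`, `i ≠ j`, in the `k`-th factor; it is `0` for `i = j`. -/
noncomputable def rootVector (k : Fin d) (i j : Fin n) : lieG n d :=
  ⟨Pi.single k (if i = j then 0 else Matrix.single i j 1), fun k' => by
    by_cases hk : k' = k
    · subst hk
      by_cases hij : i = j <;> simp [hij]
    · simp [hk]⟩

/-- The root `ε_i - ε_j` of the `k`-th factor, as a diagonal matrix. -/
noncomputable def rootWeight (k : Fin d) (i j : Fin n) : lieG n d :=
  ⟨Pi.single k (Matrix.single i i 1 - Matrix.single j j 1), fun k' => by
    by_cases hk : k' = k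
    · subst hk; simp
    · simp [hk]⟩

theorem rootWeight_mem (k : Fin d) (i j : Fin n) : rootWeight k i j ∈ iLieTK n d := by
  refine ⟨fun k' => ?_, fun k' => ?_⟩
  · by_cases hk : k' = k
    · subst hk
      simp [rootWeight, Matrix.IsHermitian, Matrix.conjTranspose_single]
    · simp [rootWeight, hk]
  · by_cases hk : k' = k
    · subst hk
      intro a b hab
      simp only [rootWeight, Pi.single_eq_same, Matrix.sub_apply, Matrix.single_apply]
      grind
    · simp [rootWeight, hk]

theorem trForm_rootWeight (A : lieG n d) (k : Fin d) (i j : Fin n) :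
    trForm A (rootWeight k i j) = A.1 k i i - A.1 k j j := by
  rw [trForm, Finset.sum_eq_single k]
  · simp [rootWeight, mul_sub, Matrix.trace_mul_single]
  · intro k' _ hk
    simp [rootWeight, hk]
  · simp

theorem rootVector_ne_zero (k : Fin d) {i j : Fin n} (hij : i ≠ j) :
    rootVector k i j ≠ 0 := by
  intro h
  have := congrFun (congrFun (congrFun (congrArg Subtype.val h) k) i) j
  simp [rootVector, hij] at this

theorem diagonal_mul_rootVector (k k' : Fin d) (i j : Fin n) (a : Fin n → ℂ) :
    Matrix.diagonal a * (rootVector k i j).1 k' = a i • (rootVector k i j).1 k' := by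
  by_cases hk : k' = k
  · subst hk
    ext p q
    simp only [rootVector, Pi.single_eq_same, Matrix.diagonal_mul, Matrix.smul_apply, smul_eq_mul]
    split_ifs with hij
    · simp
    · simp only [Matrix.single_apply]
      grind
  · simp [rootVector, hk]

theorem rootVector_mul_diagonal (k k' : Fin d) (i j : Fin n) (a : Fin n → ℂ) :
    (rootVector k i j).1 k' * Matrix.diagonal a = a j • (rootVector k i j).1 k' := by
  by_cases hk : k' = k
  · subst hk
    ext p q
    simp only [rootVector, Pi.single_eq_same, Matrix.mul_diagonal, Matrix.smul_apply, smul_eq_mul]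
    split_ifs with hij
    · simp
    · simp only [Matrix.single_apply]
      grind
  · simp [rootVector, hk]

theorem isRoot_rootWeight (k : Fin d) {i j : Fin n} (hij : i ≠ j) :
    IsRoot (rootWeight k i j) := by
  refine ⟨rootWeight_mem k i j, ?_, rootVector k i j, rootVector_ne_zero k hij, ?_⟩
  · intro h
    have := congrFun (congrFun (congrFun (congrArg Subtype.val h) k) i) i
    simp [rootWeight, hij.symm] at this
  · intro A hA k'
    by_cases hk : k' = k
    · subst hk
      rw [trForm_rootWeight, ← (hA k').diagonal_diag, diagonal_mul_rootVector,
        rootVector_mul_diagonal, ← sub_smul]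
      simp
    · simp [rootVector, hk]

theorem eq_diagPart_add_sum_rootVector {A : lieG n d} (hA : A ∈ iLieK n d) :
    A = diagPart A + ∑ k, ∑ i, ∑ j, A.1 k i j • rootVector k i j := by
  apply Subtype.ext
  funext k'
  ext p q
  have hs : (∑ k, ∑ i, ∑ j, A.1 k i j • rootVector k i j).1 k' p q
      = ∑ k, ∑ i, ∑ j, A.1 k i j * (rootVector k i j).1 k' p q := by
    simp [Finset.sum_apply, Matrix.sum_apply]
  have hs' : (∑ k, ∑ i, ∑ j, A.1 k i j • rootVector k i j).1 k' p q
      = if p = q then 0 else A.1 k' p q := by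
    rw [hs, Finset.sum_eq_single k']
    · rw [Finset.sum_eq_single p]
      · rw [Finset.sum_eq_single q]
        · by_cases hpq : p = q <;> simp [rootVector, hpq]
        · intro j _ hj
          by_cases hpj : p = j <;> simp [rootVector, hpj, hj]
        · simp
      · intro i _ hi
        refine Finset.sum_eq_zero fun j _ => ?_
        by_cases hpj : i = j <;> simp [rootVector, hpj, hi]
      · simp
    · intro k _ hk
      simp [rootVector, hk.symm]
    · simp
  change A.1 k' p q = (diagPart A).1 k' p q + _
  rw [hs']
  change _ = Matrix.diagonal (fun i => ((A.1 k' i i).re : ℂ)) p q + _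
  by_cases hpq : p = q
  · subst hpq
    simp [coe_re_apply_diag hA]
  · simp [hpq]

end SLPow

/-! ### Moment maps -/

/-- A definite bilinear form on a finite-dimensional real space represents every functional. -/
theorem exists_eq_of_definite {W : Type*} [AddCommGroup W] [Module ℝ W] [FiniteDimensional ℝ W]
    (b : W → W → ℝ) (hadd : ∀ x y z, b (x + y) z = b x z + b y z)
    (hsmul : ∀ (c : ℝ) x z, b (c • x) z = c * b x z)
    (hadd' : ∀ x y z, b x (y + z) = b x y + b x z)
    (hsmul' : ∀ (c : ℝ) x z, b x (c • z) = c * b x z) (hdef : ∀ x, b x x = 0 → x = 0)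
    (ℓ : W →ₗ[ℝ] ℝ) : ∃ x, ∀ z, b x z = ℓ z := by
  let B : W →ₗ[ℝ] Module.Dual ℝ W := LinearMap.mk₂ ℝ b hadd hsmul hadd' hsmul'
  have hinj : Function.Injective B :=
    (injective_iff_map_eq_zero B).2 fun x hx => hdef x (LinearMap.congr_fun hx x)
  obtain ⟨x, hx⟩ := (LinearMap.injective_iff_surjective_of_finrank_eq_finrank
    Subspace.dual_finrank_eq.symm).1 hinj ℓ
  exact ⟨x, fun z => LinearMap.congr_fun hx z⟩

namespace SLPow

variable {n d : ℕ}

/-- The trace form represents every real functional on a space of traceless Hermitian tuples. -/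
theorem exists_trForm_re_eq (L : Submodule ℝ (lieG n d)) (hL : L ≤ iLieK n d)
    (ℓ : L →ₗ[ℝ] ℝ) : ∃ M : L, ∀ A : L, (trForm M.1 A.1).re = ℓ A := by
  refine exists_eq_of_definite (fun M A : L => (trForm M.1 A.1).re)
    (fun M M' A => by simp [trForm_add_left]) (fun c M A => by simp [trForm_real_smul_left])
    (fun M A A' => by simp [trForm_add_right]) (fun c M A => by simp [trForm_real_smul_right])
    (fun M h => ?_) ℓ
  rw [trForm_self (hL M.2), Complex.ofReal_re] at h
  exact Subtype.ext (eq_zero_of_frobenius_eq_zero (pow_eq_zero_iff two_ne_zero |>.1 h))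

section Representation

variable {V : Type*} [NormedAddCommGroup V] [InnerProductSpace ℂ V] [FiniteDimensional ℂ V]
  {π : Representation ℂ (SLPow n d) V}

theorem inner_lieRep_self_eq_ofReal (hrat : IsRational π) (hinv : IsKInvariant π) {A : lieG n d}
    (hA : A ∈ iLieK n d) (w : V) :
    (inner ℂ w (lieRep π A w) : ℂ) = ((inner ℂ w (lieRep π A w) : ℂ).re : ℂ) := by
  refine (Complex.conj_eq_iff_re.1 ?_).symm
  rw [inner_conj_symm, inner_lieRep_left hrat hinv hA]

theorem exists_isMoment (hrat : IsRational π) (hinv : IsKInvariant π)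
    {L : Submodule ℝ (lieG n d)} (hL : L ≤ iLieK n d) (w : V) : ∃ M, IsMoment π L w M := by
  let ℓ : L →ₗ[ℝ] ℝ :=
    { toFun := fun A => (inner ℂ w (lieRep π A.1 w) : ℂ).re / ‖w‖ ^ 2
      map_add' := fun A B => by
        simp [lieRep_add hrat, add_div]
      map_smul' := fun c A => by
        simp [lieRep_real_smul hrat, mul_div_assoc] }
  obtain ⟨M, hM⟩ := exists_trForm_re_eq L hL ℓ
  refine ⟨M.1, M.2, fun A hA => ?_⟩
  rw [trForm_eq_ofReal_re (hL M.2) (hL hA), hM ⟨A, hA⟩,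
    inner_lieRep_self_eq_ofReal hrat hinv (hL hA), inner_self_eq_norm_sq_to_K]
  simp [ℓ]

theorem isMoment_momentMap (hrat : IsRational π) (hinv : IsKInvariant π)
    {L : Submodule ℝ (lieG n d)} (hL : L ≤ iLieK n d) (w : V) :
    IsMoment π L w (momentMap π L w) := by
  have h := exists_isMoment hrat hinv hL w
  rw [momentMap, dif_pos h]
  exact h.choose_spec

theorem IsMoment.unique {L : Submodule ℝ (lieG n d)} (hL : L ≤ iLieK n d) {w : V}
    {M M' : lieG n d} (h : IsMoment π L w M) (h' : IsMoment π L w M') : M = M' := by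
  have hmem := L.sub_mem h.1 h'.1
  have h0 : trForm (M - M') (M - M') = 0 := by
    rw [trForm_sub_left, h.2 _ hmem, h'.2 _ hmem, sub_self]
  rw [trForm_self (hL hmem), Complex.ofReal_eq_zero] at h0
  exact sub_eq_zero.1 (eq_zero_of_frobenius_eq_zero (pow_eq_zero_iff two_ne_zero |>.1 h0))

/-! ### Weight vectors -/

theorem mem_weightSpace_of_forall_lieRep (hrat : IsRational π) {ω : lieG n d} {x : V}
    (h : ∀ A ∈ iLieTK n d, lieRep π A x = trForm A ω • x) : x ∈ weightSpace π ω := by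
  have : CompleteSpace V := FiniteDimensional.complete ℂ V
  intro A hA
  have h1 : lieRep π A x = trForm A ω • x := by
    obtain ⟨B, hB, C, hC, rfl⟩ := exists_eq_add_I_smul_of_mem_lieT hA
    rw [lieRep_add hrat, lieRep_smul hrat, add_apply, smul_apply, h B hB, h C hC,
      trForm_add_left, trForm_smul_left, add_smul, mul_smul]
  rw [← opRep_apply, opRep_exp hrat]
  exact ContinuousLinearMap.exp_apply_of_apply_eq_smul h1

omit [FiniteDimensional ℂ V] in
theorem rep_mem_weightSpace {t : SLPow n d} (ht : t ∈ torus n d) {ω : lieG n d} {x : V}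
    (hx : x ∈ weightSpace π ω) : π t x ∈ weightSpace π ω := by
  intro A hA
  have h : t * exp A = exp A * t := by
    have := mul_exp_eq_exp_mul t (B := A) (B' := A) (fun k => by
      rw [← (ht k).diagonal_diag, ← (hA k).diagonal_diag, Matrix.diagonal_mul_diagonal,
        Matrix.diagonal_mul_diagonal]
      simp only [mul_comm]) 1
    simpa using this
  have h1 : π (exp A) (π t x) = π t (π (exp A) x) := by
    rw [← Module.End.mul_apply, ← Module.End.mul_apply, ← map_mul, ← map_mul, h]
  rw [h1, hx A hA, map_smul]

/-- A root vector shifts weights by its root, because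
`e ^ A E e ^ (-A) = e ^ (tr (A α)) E` for diagonal `A`. -/
theorem lieRep_rootVector_mem_weightSpace (hrat : IsRational π) (k : Fin d) {i j : Fin n}
    {ω : lieG n d} {x : V} (hx : x ∈ weightSpace π ω) :
    lieRep π (rootVector k i j) x ∈ weightSpace π (ω + rootWeight k i j) := by
  intro A hA
  have hconj : ∀ k', (exp A k' : Matrix (Fin n) (Fin n) ℂ) * (rootVector k i j).1 k' =
      (Complex.exp (trForm A (rootWeight k i j)) • rootVector k i j).1 k' * exp A k' := by
    intro k'
    change NormedSpace.exp (A.1 k') * (rootVector k i j).1 k' =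
      (Complex.exp (trForm A (rootWeight k i j)) • (rootVector k i j).1 k') *
        NormedSpace.exp (A.1 k')
    by_cases hk : k' = k
    · subst hk
      rw [trForm_rootWeight, ← (hA k').diagonal_diag, Matrix.exp_diagonal, smul_mul_assoc,
        diagonal_mul_rootVector, rootVector_mul_diagonal, smul_smul, Pi.coe_exp, Pi.coe_exp,
        ← Complex.exp_eq_exp_ℂ, ← Complex.exp_add]
      simp
    · simp [rootVector, hk]
  have h := congrArg (fun T : V →L[ℂ] V => T x) (opRep_mul_lieRep hrat (exp A) hconj)
  simp only [mul_apply_eq_comp, opRep_apply, hx A hA, lieRep_smul hrat, smul_apply,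
    map_smul] at h
  rw [h, smul_smul, ← Complex.exp_add, trForm_add_right]

/-- Distinct weight spaces are orthogonal: `π(e ^ A)` with `A = ω - ω'` is self-adjoint and acts on
them by different real scalars. -/
theorem inner_eq_zero_of_mem_weightSpace (hrat : IsRational π) (hinv : IsKInvariant π)
    {ω ω' : lieG n d} (hω : ω ∈ iLieTK n d) (hω' : ω' ∈ iLieTK n d) (hne : ω ≠ ω') {x y : V}
    (hx : x ∈ weightSpace π ω) (hy : y ∈ weightSpace π ω') : inner ℂ x y = 0 := by
  by_contra h0
  have hA : ω - ω' ∈ iLieTK n d := Submodule.sub_mem _ hω hω'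
  have h := inner_rep_exp_left hrat hinv hA.1 x y
  have hr := trForm_eq_ofReal_re hA.1 hω.1
  have hr' := trForm_eq_ofReal_re hA.1 hω'.1
  rw [hx _ hA.2, hy _ hA.2, inner_smul_left, inner_smul_right, hr, hr', ← Complex.exp_conj,
    Complex.conj_ofReal, mul_left_inj' h0, ← Complex.ofReal_exp, ← Complex.ofReal_exp,
    Complex.ofReal_inj, Real.exp_eq_exp] at h
  have h1 : trForm (ω - ω') (ω - ω') = 0 := by
    rw [trForm_sub_right, hr, hr', h, sub_self]
  rw [trForm_self hA.1, Complex.ofReal_eq_zero] at h1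
  exact hne (sub_eq_zero.1 (eq_zero_of_frobenius_eq_zero (pow_eq_zero_iff two_ne_zero |>.1 h1)))

/-- Weight decompositions exist: the operators `Π(A)`, `A ∈ i Lie(T_K)`, are commuting and
self-adjoint, and the weight of a joint eigenvector is its moment for `T`. -/
theorem exists_isWeightDecomposition (hrat : IsRational π) (hinv : IsKInvariant π) (v : V) :
    ∃ c, IsWeightDecomposition π v c := by
  have hT := LinearMap.IsSymmetric.iSup_iInf_eq_top_of_commute
    (T := fun A : iLieTK n d => (lieRep π A.1).toLinearMap)
    (fun A x y => inner_lieRep_left hrat hinv A.2.1 x y)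
    (fun A B _ => by
      have h : Commute (lieRep π A.1) (lieRep π B.1) := commute_lieRep hrat fun k => by
        rw [eq_diagonal_of_mem_iLieTK A.2, eq_diagonal_of_mem_iLieTK B.2]
        exact Matrix.commute_diagonal _ _
      exact congrArg ContinuousLinearMap.toLinearMap h)
  have hle : (⊤ : Submodule ℂ V) ≤
      ⨆ ω : lieG n d, ⨆ _ : ω ∈ iLieTK n d, weightSpace π ω := by
    rw [← hT]
    refine iSup_le fun χ x hx => ?_
    by_cases hx0 : x = 0
    · rw [hx0]; exact Submodule.zero_mem _
    obtain ⟨ω, hω⟩ := exists_isMoment hrat hinv (iLieTK_le_iLieK (n := n) (d := d)) x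
    refine Submodule.mem_iSup_of_mem ω (Submodule.mem_iSup_of_mem hω.1 ?_)
    refine mem_weightSpace_of_forall_lieRep hrat fun A hA => ?_
    have h1 : lieRep π A x = χ ⟨A, hA⟩ • x :=
      Module.End.mem_eigenspace_iff.1 ((Submodule.mem_iInf _).1 hx ⟨A, hA⟩)
    have h2 := hω.2 A hA
    rw [h1, inner_smul_right, mul_div_cancel_right₀ _ (inner_self_ne_zero.2 hx0)] at h2
    rw [h1, trForm_comm, h2]
  obtain ⟨c, hc, hsum⟩ := (Submodule.mem_iSup_iff_exists_finsupp _ v).1 (hle Submodule.mem_top)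
  refine ⟨c, fun ω hω => ?_, fun ω => ?_, hsum⟩
  · by_contra hn
    have := hc ω
    simp only [hn, iSup_false, Submodule.mem_bot] at this
    exact (Finsupp.mem_support_iff.1 hω) this
  · exact (iSup_le fun _ => le_rfl : (⨆ _ : ω ∈ iLieTK n d, weightSpace π ω) ≤ _) (hc ω)

/-! ### Free supports -/

theorem inner_lieRep_rootVector_eq_zero (hrat : IsRational π) (hinv : IsKInvariant π) {v : V}
    (hfree : IsFree (weightSupport π v)) {t : SLPow n d} (ht : t ∈ torus n d)
    (k : Fin d) (i j : Fin n) :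
    inner ℂ (π t v) (lieRep π (rootVector k i j) (π t v)) = 0 := by
  obtain ⟨c, hc⟩ := exists_isWeightDecomposition hrat hinv v
  by_cases hij : i = j
  · have h0 : rootVector k i j = (0 : ℂ) • rootVector k i j := by
      rw [zero_smul]
      apply Subtype.ext
      funext k'
      simp [rootVector, hij]
    rw [h0, lieRep_smul hrat]
    simp
  have hv : π t v = ∑ ω ∈ c.support, π t (c ω) := by
    conv_lhs => rw [← hc.2.2, Finsupp.sum, map_sum]
  rw [hv, map_sum, sum_inner]
  refine Finset.sum_eq_zero fun ω' hω' => ?_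
  rw [inner_sum]
  refine Finset.sum_eq_zero fun ω hω => ?_
  have hroot := isRoot_rootWeight k hij
  refine inner_eq_zero_of_mem_weightSpace hrat hinv (hc.1 _ hω')
    (Submodule.add_mem _ (hc.1 _ hω) (rootWeight_mem k i j)) ?_
    (rep_mem_weightSpace ht (hc.2.1 ω'))
    (lieRep_rootVector_mem_weightSpace hrat k (rep_mem_weightSpace ht (hc.2.1 ω)))
  intro heq
  refine hfree ω' ⟨c, hc, Finsupp.mem_support_iff.1 hω'⟩ ω ⟨c, hc, Finsupp.mem_support_iff.1 hω⟩
    ?_ ?_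
  · rintro rfl
    exact hroot.2.1 (by simpa using heq)
  · rw [heq, add_sub_cancel_left]
    exact hroot

theorem momentT_eq_momentG_of_isFree (hrat : IsRational π) (hinv : IsKInvariant π) {v : V}
    (hfree : IsFree (weightSupport π v)) {t : SLPow n d} (ht : t ∈ torus n d) :
    momentT π (π t v) = momentG π (π t v) := by
  have hM := isMoment_momentMap hrat hinv (iLieTK_le_iLieK (n := n) (d := d)) (π t v)
  refine IsMoment.unique le_rfl ⟨hM.1.1, fun A hA => ?_⟩
    (isMoment_momentMap hrat hinv le_rfl (π t v))
  obtain ⟨D, hD⟩ := exists_linearMap_hasDerivAt hrat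
  have hl : ∀ A, lieRep π A = D A := fun A => (hD A).deriv
  have h0 : (inner ℂ (π t v) (lieRep π (∑ k, ∑ i, ∑ j, A.1 k i j • rootVector k i j) (π t v)) : ℂ)
      = 0 := by
    have := inner_lieRep_rootVector_eq_zero hrat hinv hfree ht
    simp only [hl] at this
    simp [hl, this]
  rw [momentT, ← trForm_diagPart hM.1.2 hA, hM.2 _ (diagPart_mem A)]
  conv_rhs => rw [eq_diagPart_add_sum_rootVector hA]
  rw [lieRep_add hrat, add_apply, inner_add_right, h0, add_zero]

end Representation

end SLPow

/-! ### Minimizers on geodesic balls -/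

namespace SLPow

variable {n d : ℕ}

theorem exp_mem_posDef {A : lieG n d} (hA : A ∈ iLieK n d) : exp A ∈ posDef n d :=
  fun k => (hA k).posDef_exp

theorem exists_exp_eq_of_mem_posDef {p : SLPow n d} (hp : p ∈ posDef n d) :
    ∃ A ∈ iLieK n d, p = exp A := by
  choose Y hY hexp htr using fun k => (hp k).exists_isHermitian_exp_eq
  refine ⟨⟨Y, fun k => htr k (p k).2⟩, hY, ?_⟩
  funext k
  exact Subtype.ext (hexp k).symm

theorem exp_apply_of_mem_iLieTK {H : lieG n d} (hH : H ∈ iLieTK n d) (c : ℝ) (k : Fin d) :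
    (exp (c • H) k : Matrix (Fin n) (Fin n) ℂ) =
      Matrix.diagonal fun i => (Real.exp (c * (H.1 k i i).re) : ℂ) := by
  change NormedSpace.exp (c • H.1 k) = _
  rw [← Matrix.exp_diagonal_ofReal, eq_diagonal_of_mem_iLieTK hH, ← Matrix.diagonal_smul]
  congr 2
  funext i
  simp

theorem exp_mem_torus {H : lieG n d} (hH : H ∈ iLieTK n d) : exp H ∈ torus n d := by
  intro k
  rw [← one_smul ℝ H, exp_apply_of_mem_iLieTK hH]
  exact Matrix.isDiag_diagonal _

theorem frobenius_add_smul_sq {H D : lieG n d} (hH : H ∈ iLieK n d) (hD : D ∈ iLieK n d) (s : ℝ) :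
    frobenius (H + s • D) ^ 2 =
      frobenius H ^ 2 + s * (2 * (trForm H D).re + s * frobenius D ^ 2) := by
  have h := trForm_self (Submodule.add_mem _ hH (Submodule.smul_mem _ s hD))
  rw [trForm_add_left, trForm_add_right, trForm_add_right, trForm_real_smul_left,
    trForm_real_smul_left, trForm_real_smul_right, trForm_real_smul_right, trForm_self hH,
    trForm_self hD, trForm_comm D H, trForm_eq_ofReal_re hH hD] at h
  have h2 := congrArg Complex.re h
  simp only [← Complex.ofReal_mul, ← Complex.ofReal_add, Complex.ofReal_re] at h2
  linarith

/-- From `‖H - Y‖ ^ 2 ≥ 0`. -/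
theorem two_mul_re_trForm_le {H Y : lieG n d} (hH : H ∈ iLieK n d) (hY : Y ∈ iLieK n d) :
    2 * (trForm H Y).re ≤ frobenius H ^ 2 + frobenius Y ^ 2 := by
  have := frobenius_add_smul_sq hH hY (-1)
  nlinarith [sq_nonneg (frobenius (H + (-1 : ℝ) • Y))]

/-- Every `e ^ Y` in `P` is reached by a geodesic `e ^ (H / 2) e ^ (s X) e ^ (H / 2)` from the
point `e ^ H` of the flat, and the angle comparison holds for its direction `X`. -/
theorem exists_geodesic {H Y : lieG n d} (hH : H ∈ iLieTK n d) (hY : Y ∈ iLieK n d) :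
    ∃ X ∈ iLieK n d, exp Y = exp ((2⁻¹ : ℝ) • H) * exp X * exp ((2⁻¹ : ℝ) • H) ∧
      frobenius H ^ 2 + (trForm H X).re ≤ (trForm H Y).re := by
  choose X hX hexp htr using fun k =>
    (hY k).exists_exp_eq_diagonal_congr fun i => -((H.1 k i i).re / 2)
  have hexp' : ∀ k, NormedSpace.exp (Y.1 k) =
      Matrix.diagonal (fun i => (Real.exp ((H.1 k i i).re / 2) : ℂ)) * NormedSpace.exp (X k) *
        Matrix.diagonal (fun i => (Real.exp ((H.1 k i i).re / 2) : ℂ)) := by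
    intro k
    have h1 : Matrix.diagonal (fun i => (Real.exp ((H.1 k i i).re / 2) : ℂ)) *
        Matrix.diagonal (fun i => (Real.exp (-((H.1 k i i).re / 2)) : ℂ)) = 1 := by
      rw [Matrix.diagonal_mul_diagonal, ← Matrix.diagonal_one]
      congr 1
      funext i
      rw [← Complex.ofReal_mul, ← Real.exp_add]
      simp
    have h2 := mul_eq_one_comm.1 h1
    rw [hexp k, ← mul_assoc, ← mul_assoc, h1, one_mul, mul_assoc, h2, mul_one]
  have hX' : ∀ k, (X k).trace = 0 := fun k => by
    refine htr k (det_exp_of_trace_eq_zero _ (Y.2 k)) ?_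
    rw [Finset.sum_neg_distrib, ← Finset.sum_div, sum_re_diag_eq_zero]
    simp
  refine ⟨⟨X, hX'⟩, hX, ?_, ?_⟩
  · funext k
    apply Subtype.ext
    change NormedSpace.exp (Y.1 k) =
      (exp ((2⁻¹ : ℝ) • H) k : Matrix (Fin n) (Fin n) ℂ) * NormedSpace.exp (X k) *
        (exp ((2⁻¹ : ℝ) • H) k : Matrix (Fin n) (Fin n) ℂ)
    rw [hexp' k, exp_apply_of_mem_iLieTK hH]
    simp only [div_eq_inv_mul]
  · have hre : ∀ Z : lieG n d, (trForm H Z).re = ∑ k, ∑ i, (H.1 k i i).re * (Z.1 k i i).re := by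
      intro Z
      rw [trForm_eq_sum_of_mem_lieT hH.2]
      simp only [Complex.re_sum]
      refine Finset.sum_congr rfl fun k _ => Finset.sum_congr rfl fun i _ => ?_
      rw [← coe_re_apply_diag hH.1, Complex.re_ofReal_mul, Complex.ofReal_re]
    have hfrob : frobenius H ^ 2 = ∑ k, ∑ i, (H.1 k i i).re ^ 2 := by
      rw [← Complex.ofReal_re (frobenius H ^ 2), ← trForm_self hH.1, hre]
      simp only [sq]
    rw [hfrob, hre, hre, ← Finset.sum_add_distrib]
    exact Finset.sum_le_sum fun k _ => Matrix.sum_sq_add_le_of_exp_eq _ (hX k) (hY k) (hexp' k)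

section Representation

variable {V : Type*} [NormedAddCommGroup V] [InnerProductSpace ℂ V] [FiniteDimensional ℂ V]
  {π : Representation ℂ (SLPow n d) V}

omit [FiniteDimensional ℂ V] in
theorem rep_mul_apply (g h : SLPow n d) (x : V) : π (g * h) x = π g (π h x) := by
  rw [map_mul, Module.End.mul_apply]

theorem norm_sq_rep_exp (hrat : IsRational π) (hinv : IsKInvariant π) {A : lieG n d}
    (hA : A ∈ iLieK n d) (w : V) : ‖π (exp A) w‖ ^ 2 = fv π w (exp ((2 : ℝ) • A)) := by
  have h : exp ((2 : ℝ) • A) = exp A * exp A := by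
    have := exp_add_smul A 1 1
    rwa [one_add_one_eq_two, one_smul] at this
  rw [fv, h, rep_mul_apply, ← inner_rep_exp_left hrat hinv hA, inner_self_eq_norm_sq_to_K]
  norm_cast

theorem fv_conj (hrat : IsRational π) (hinv : IsKInvariant π) {A : lieG n d}
    (hA : A ∈ iLieK n d) (g : SLPow n d) (w : V) :
    fv π w (exp A * g * exp A) = fv π (π (exp A) w) g := by
  rw [fv, fv, rep_mul_apply, rep_mul_apply, inner_rep_exp_left hrat hinv hA]

theorem fv_exp_nonneg (hrat : IsRational π) (hinv : IsKInvariant π) {A : lieG n d}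
    (hA : A ∈ iLieK n d) (w : V) : 0 ≤ fv π w (exp A) := by
  have h := norm_sq_rep_exp hrat hinv (Submodule.smul_mem _ (2⁻¹ : ℝ) hA) w
  rw [smul_smul, mul_inv_cancel₀ two_ne_zero, one_smul] at h
  rw [← h]
  positivity

/-- Midpoint convexity between `0` and `A`, by the Cauchy-Schwarz inequality applied to
`⟨w, π(e ^ (A / 2)) w⟩`. -/
theorem fv_exp_half_le (hrat : IsRational π) (hinv : IsKInvariant π) {A : lieG n d}
    (hA : A ∈ iLieK n d) (w : V) :
    fv π w (exp ((2⁻¹ : ℝ) • A)) ≤ (‖w‖ ^ 2 + fv π w (exp A)) / 2 := by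
  have h := norm_sq_rep_exp hrat hinv (Submodule.smul_mem _ (2⁻¹ : ℝ) hA) w
  rw [smul_smul, mul_inv_cancel₀ two_ne_zero, one_smul] at h
  rw [← h]
  have h1 : fv π w (exp ((2⁻¹ : ℝ) • A)) ≤ ‖w‖ * ‖π (exp ((2⁻¹ : ℝ) • A)) w‖ :=
    re_inner_le_norm (𝕜 := ℂ) w (π (exp ((2⁻¹ : ℝ) • A)) w)
  nlinarith [sq_nonneg (‖w‖ - ‖π (exp ((2⁻¹ : ℝ) • A)) w‖)]

/-- The function `s ↦ ⟨w, π(e ^ (s X)) w⟩` lies above its tangent at `0`, because it is midpoint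
convex between `0` and any other point. -/
theorem norm_sq_add_re_inner_lieRep_le (hrat : IsRational π) (hinv : IsKInvariant π) {X : lieG n d}
    (hX : X ∈ iLieK n d) (w : V) :
    ‖w‖ ^ 2 + (inner ℂ w (lieRep π X w) : ℂ).re ≤ fv π w (exp X) := by
  have hm : ∀ m : ℕ, ((2⁻¹ : ℝ) ^ m)⁻¹ * (fv π w (exp ((2⁻¹ : ℝ) ^ m • X)) - ‖w‖ ^ 2)
      ≤ fv π w (exp X) - ‖w‖ ^ 2 := by
    intro m
    induction m with
    | zero => simp
    | succ m ih =>
      refine le_trans ?_ ih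
      have h := fv_exp_half_le hrat hinv (Submodule.smul_mem _ ((2⁻¹ : ℝ) ^ m) hX) w
      rw [smul_smul, ← pow_succ'] at h
      have hp : (0 : ℝ) < ((2⁻¹ : ℝ) ^ m)⁻¹ := by positivity
      have he : ((2⁻¹ : ℝ) ^ (m + 1))⁻¹ = ((2⁻¹ : ℝ) ^ m)⁻¹ * 2 := by
        rw [pow_succ, mul_inv, inv_inv]
      rw [he, mul_assoc]
      refine mul_le_mul_of_nonneg_left ?_ hp.le
      linarith
  have ht := (hasDerivAt_inner_rep_exp hrat X w).tendsto_slope_zero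
  have h2 : Filter.Tendsto (fun m : ℕ => (2⁻¹ : ℝ) ^ m) Filter.atTop (nhdsWithin 0 {0}ᶜ) :=
    tendsto_nhdsWithin_iff.mpr ⟨tendsto_pow_atTop_nhds_zero_of_lt_one (by norm_num) (by norm_num),
      Filter.Eventually.of_forall fun m => by
        simp only [Set.mem_compl_iff, Set.mem_singleton_iff]; positivity⟩
  have h3 := le_of_tendsto' (ht.comp h2) (b := fv π w (exp X) - ‖w‖ ^ 2) fun m => by
    refine le_trans (le_of_eq ?_) (hm m)
    have h0 : (inner ℂ w w : ℂ).re = ‖w‖ ^ 2 := by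
      rw [inner_self_eq_norm_sq_to_K]; norm_cast
    simp only [Function.comp_apply, zero_add, zero_smul, exp_zero, map_one, Module.End.one_apply,
      smul_eq_mul, h0]
    rfl
  linarith

/-- The flat ball, parametrized by the diagonals of its elements, is compact. -/
theorem exists_isMinOn_flat (hrat : IsRational π) (v : V) {R : ℝ} (hR : 0 ≤ R) :
    ∃ H ∈ iLieTK n d, frobenius H ≤ R ∧ ∀ H' ∈ iLieTK n d, frobenius H' ≤ R →
      fv π v (exp H) ≤ fv π v (exp H') := by
  let S : Set (Fin d → Fin n → ℝ) :=
    {a | (∀ k, ∑ i, a k i = 0) ∧ ∑ k, ∑ i, a k i ^ 2 ≤ R ^ 2}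
  have hS : IsCompact S := by
    refine Metric.isCompact_of_isClosed_isBounded ?_ ?_
    · have hSeq : S = (⋂ k, {a : Fin d → Fin n → ℝ | ∑ i, a k i = 0}) ∩
          {a | ∑ k, ∑ i, a k i ^ 2 ≤ R ^ 2} := by
        ext a
        simp [S]
      rw [hSeq]
      exact (isClosed_iInter fun k => isClosed_eq (by fun_prop) continuous_const).inter
        (isClosed_le (by fun_prop) continuous_const)
    · refine (Metric.isBounded_closedBall (x := (0 : Fin d → Fin n → ℝ)) (r := R)).subset ?_
      intro a ha
      rw [mem_closedBall_zero_iff, pi_norm_le_iff_of_nonneg hR]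
      intro k
      rw [pi_norm_le_iff_of_nonneg hR]
      intro i
      have h1 : a k i ^ 2 ≤ ∑ i, a k i ^ 2 :=
        Finset.single_le_sum (f := fun i => a k i ^ 2) (fun _ _ => sq_nonneg _) (Finset.mem_univ i)
      have h2 : ∑ i, a k i ^ 2 ≤ ∑ k, ∑ i, a k i ^ 2 :=
        Finset.single_le_sum (f := fun k => ∑ i, a k i ^ 2)
          (fun _ _ => Finset.sum_nonneg fun _ _ => sq_nonneg _) (Finset.mem_univ k)
      exact abs_le_of_sq_le_sq (h1.trans (h2.trans ha.2)) hR
  have : CompactSpace S := isCompact_iff_compactSpace.1 hS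
  have : Nonempty S := ⟨0, by simp [S, sq_nonneg]⟩
  have hcont : Continuous fun a : S => fv π v (exp (diagTuple a.1 a.2.1)) := by
    have h1 : Continuous fun a : S => opRep π (exp (diagTuple a.1 a.2.1)) := by
      refine continuous_opRep_comp hrat fun k i j => ?_
      have h : ∀ a : S, (exp (diagTuple a.1 a.2.1) k : Matrix (Fin n) (Fin n) ℂ) i j =
          if i = j then (Real.exp (a.1 k i) : ℂ) else 0 := by
        intro a
        change NormedSpace.exp (Matrix.diagonal fun i => (a.1 k i : ℂ)) i j = _
        rw [Matrix.exp_diagonal_ofReal, Matrix.diagonal_apply]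
      simp only [h]
      split_ifs
      · have hc : Continuous fun a : S => a.1 k i :=
          (continuous_apply_apply k i).comp continuous_subtype_val
        exact Complex.continuous_ofReal.comp (Real.continuous_exp.comp hc)
      · exact continuous_const
    exact Complex.continuous_re.comp
      (continuous_const.inner ((ContinuousLinearMap.apply ℂ V v).continuous.comp h1))
  obtain ⟨a, -, ha⟩ := isCompact_univ.exists_isMinOn Set.univ_nonempty hcont.continuousOn
  have hfrob : ∀ (b : Fin d → Fin n → ℝ) (hb : ∀ k, ∑ i, b k i = 0),
      frobenius (diagTuple b hb) ^ 2 = ∑ k, ∑ i, b k i ^ 2 := by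
    intro b hb
    rw [frobenius_sq]
    refine Finset.sum_congr rfl fun k _ => Finset.sum_congr rfl fun i _ => ?_
    rw [Finset.sum_eq_single i]
    · simp [diagTuple]
    · intro j _ hj
      simp [diagTuple, hj.symm]
    · simp
  refine ⟨diagTuple a.1 a.2.1, diagTuple_mem _ _, ?_, fun H' hH' hle => ?_⟩
  · exact abs_le_of_sq_le_sq' (by rw [hfrob]; exact a.2.2) hR |>.2
  · have he : H' = diagTuple (fun k i => (H'.1 k i i).re) (sum_re_diag_eq_zero H') := by
      apply Subtype.ext
      funext k
      exact eq_diagonal_of_mem_iLieTK hH' k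
    have hmem : (fun k i => (H'.1 k i i).re) ∈ S := by
      refine ⟨sum_re_diag_eq_zero H', ?_⟩
      rw [← hfrob _ (sum_re_diag_eq_zero H'), ← he]
      exact pow_le_pow_left₀ (frobenius_nonneg _) hle 2
    have := ha (Set.mem_univ (⟨_, hmem⟩ : S))
    simp only [Set.mem_ofPred_eq] at this
    rwa [← he] at this

/-- The first-order condition at a minimizer on the flat ball, in directions that are interior to
the ball to first order. -/
theorem re_inner_lieRep_nonneg_of_isMinOn (hrat : IsRational π) (hinv : IsKInvariant π) {v : V}
    {R : ℝ} (hR : 0 ≤ R) {H : lieG n d} (hH : H ∈ iLieTK n d) (hHR : frobenius H ≤ R)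
    (hmin : ∀ H' ∈ iLieTK n d, frobenius H' ≤ R → fv π v (exp H) ≤ fv π v (exp H'))
    {D : lieG n d} (hD : D ∈ iLieTK n d) (hdir : frobenius H < R ∨ (trForm H D).re < 0) :
    0 ≤ (inner ℂ (π (exp ((2⁻¹ : ℝ) • H)) v)
      (lieRep π D (π (exp ((2⁻¹ : ℝ) • H)) v)) : ℂ).re := by
  set w := π (exp ((2⁻¹ : ℝ) • H)) v with hw
  have hball : ∀ᶠ s in nhdsWithin (0 : ℝ) (Set.Ioi 0), frobenius (H + s • D) ≤ R := by
    have hsq : ∀ᶠ s in nhdsWithin (0 : ℝ) (Set.Ioi 0), frobenius (H + s • D) ^ 2 ≤ R ^ 2 := by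
      simp only [frobenius_add_smul_sq hH.1 hD.1]
      have hHR2 : frobenius H ^ 2 ≤ R ^ 2 := pow_le_pow_left₀ (frobenius_nonneg _) hHR 2
      rcases hdir with h | h
      · have hlt : frobenius H ^ 2 < R ^ 2 := pow_lt_pow_left₀ h (frobenius_nonneg _) two_ne_zero
        have hc : Filter.Tendsto (fun s : ℝ => frobenius H ^ 2 +
            s * (2 * (trForm H D).re + s * frobenius D ^ 2)) (nhds 0)
            (nhds (frobenius H ^ 2)) := by
          refine Continuous.tendsto' (by fun_prop) _ _ (by simp)
        filter_upwards [(hc.eventually_lt_const hlt).filter_mono nhdsWithin_le_nhds] with s hs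
        exact hs.le
      · have hc : Filter.Tendsto (fun s : ℝ => 2 * (trForm H D).re + s * frobenius D ^ 2) (nhds 0)
            (nhds (2 * (trForm H D).re)) := by
          refine Continuous.tendsto' (by fun_prop) _ _ (by simp)
        filter_upwards [(hc.eventually_lt_const (by linarith : _ < (0 : ℝ))).filter_mono
          nhdsWithin_le_nhds, self_mem_nhdsWithin] with s hs hs0
        have hs0' : 0 < s := hs0
        nlinarith
    filter_upwards [hsq] with s hs
    exact (abs_le_of_sq_le_sq' hs hR).2
  have hshift : ∀ s : ℝ, fv π v (exp (H + s • D)) = fv π w (exp (s • D)) := by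
    intro s
    have hcomm : ∀ k, Commute (H.1 k) (D.1 k) := fun k => by
      rw [eq_diagonal_of_mem_iLieTK hH, eq_diagonal_of_mem_iLieTK hD]
      exact Matrix.commute_diagonal _ _
    have he : exp (H + s • D) = exp ((2⁻¹ : ℝ) • H) * exp (s • D) * exp ((2⁻¹ : ℝ) • H) := by
      rw [← exp_add_of_commute _ _ fun k => ((hcomm k).smul_left (2⁻¹ : ℝ)).smul_right s,
        ← exp_add_of_commute]
      · congr 1
        module
      · intro k
        exact (((Commute.refl (H.1 k)).smul_left (2⁻¹ : ℝ)).add_left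
          ((hcomm k).symm.smul_left s)).smul_right (2⁻¹ : ℝ)
    rw [he, fv_conj hrat hinv (Submodule.smul_mem _ _ hH.1)]
  have ht := (hasDerivAt_inner_rep_exp hrat D w).tendsto_slope_zero_right
  refine ge_of_tendsto ht ?_
  filter_upwards [hball, self_mem_nhdsWithin] with s hs hs0
  have hs0' : 0 < s := hs0
  have h1 := hmin _ (Submodule.add_mem _ hH (Submodule.smul_mem _ s hD)) hs
  have h2 := hshift 0
  rw [zero_smul, add_zero] at h2
  rw [hshift, h2] at h1
  simp only [zero_add, zero_smul, smul_eq_mul]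
  exact mul_nonneg (inv_nonneg.2 hs0'.le) (sub_nonneg.2 h1)

theorem re_inner_lieRep_diagPart (hrat : IsRational π) (hinv : IsKInvariant π) {w : V}
    (hw : momentT π w = momentG π w) {X : lieG n d} (hX : X ∈ iLieK n d) :
    (inner ℂ w (lieRep π (diagPart X) w) : ℂ) = inner ℂ w (lieRep π X w) := by
  by_cases h0 : w = 0
  · simp [h0]
  have hT := isMoment_momentMap hrat hinv (iLieTK_le_iLieK (n := n) (d := d)) w
  have hG := isMoment_momentMap hrat hinv (le_refl (iLieK n d)) w
  have h1 := hT.2 _ (diagPart_mem X)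
  have h2 := hG.2 _ hX
  have hw' : momentMap π (iLieTK n d) w = momentMap π (iLieK n d) w := hw
  rw [trForm_diagPart hT.1.2 hX, hw', h2] at h1
  exact ((div_left_inj' (inner_self_ne_zero.2 h0)).1 h1).symm

/-- If the moment maps agree along the torus orbit, a minimizer on the flat ball is a minimizer on
the whole geodesic ball. -/
theorem exists_flat_minimizer (hrat : IsRational π) (hinv : IsKInvariant π) {v : V}
    (hmom : ∀ t ∈ torus n d, momentT π (π t v) = momentG π (π t v)) {R : ℝ} (hR : 0 < R) :
    ∃ H ∈ iLieTK n d, frobenius H ≤ R ∧ ∀ g ∈ ball n d R, fv π v (exp H) ≤ fv π v g := by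
  obtain ⟨H, hH, hHR, hmin⟩ := exists_isMinOn_flat hrat v hR.le
  refine ⟨H, hH, hHR, ?_⟩
  rintro g ⟨Y, hY, hYR, rfl⟩
  obtain ⟨X, hX, hexp, htr⟩ := exists_geodesic hH hY
  have hHh : (2⁻¹ : ℝ) • H ∈ iLieTK n d := Submodule.smul_mem _ _ hH
  set w := π (exp ((2⁻¹ : ℝ) • H)) v with hw
  have hfoc := fun (D : lieG n d) hD hdir =>
    re_inner_lieRep_nonneg_of_isMinOn hrat hinv hR.le hH hHR hmin (D := D) hD hdir
  rw [← hw] at hfoc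
  have hD : 0 ≤ (inner ℂ w (lieRep π (diagPart X) w) : ℂ).re := by
    rcases hHR.lt_or_eq with hlt | heq
    · exact hfoc _ (diagPart_mem X) (Or.inl hlt)
    · have hle : (trForm H (diagPart X)).re ≤ 0 := by
        rw [trForm_diagPart hH.2 hX]
        have h1 := two_mul_re_trForm_le hH.1 hY
        have h2 : frobenius Y ^ 2 ≤ frobenius H ^ 2 := by
          rw [heq]; exact pow_le_pow_left₀ (frobenius_nonneg _) hYR 2
        linarith
      -- `diagPart X` itself may be tangent to the sphere, so it is tilted inwards first.
      have hε : ∀ ε : ℝ, 0 < ε → ε * (inner ℂ w (lieRep π H w) : ℂ).re ≤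
          (inner ℂ w (lieRep π (diagPart X) w) : ℂ).re := by
        intro ε hε
        have h := hfoc (diagPart X + (-ε) • H)
          (Submodule.add_mem _ (diagPart_mem X) (Submodule.smul_mem _ _ hH)) (Or.inr (by
            rw [trForm_add_right, trForm_real_smul_right, trForm_self hH.1, heq,
              ← Complex.ofReal_mul, Complex.add_re, Complex.ofReal_re]
            nlinarith [mul_pos hε (pow_pos hR 2)]))
        rw [lieRep_add hrat, lieRep_real_smul hrat, add_apply, smul_apply, inner_add_right,
          inner_smul_right, Complex.add_re, Complex.re_ofReal_mul] at h
        linarith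
      have hlim : Filter.Tendsto (fun ε : ℝ => ε * (inner ℂ w (lieRep π H w) : ℂ).re)
          (nhdsWithin 0 (Set.Ioi 0)) (nhds 0) :=
        (Continuous.tendsto' (by fun_prop) _ _ (by simp)).mono_left nhdsWithin_le_nhds
      refine le_of_tendsto hlim ?_
      filter_upwards [self_mem_nhdsWithin] with ε h
      exact hε ε h
  rw [re_inner_lieRep_diagPart hrat hinv (w := w) (hmom _ (exp_mem_torus hHh)) hX] at hD
  have h1 := norm_sq_add_re_inner_lieRep_le hrat hinv hX w
  have h2 : fv π v (exp H) = ‖w‖ ^ 2 := by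
    rw [hw, norm_sq_rep_exp hrat hinv hHh.1, smul_smul, mul_inv_cancel₀ two_ne_zero, one_smul]
  rw [hexp, fv_conj hrat hinv hHh.1, h2, ← hw]
  linarith

/-! ### Equality of the infima -/

theorem sInf_fv_ball_eq (hrat : IsRational π) (hinv : IsKInvariant π) {v : V}
    (hmom : ∀ t ∈ torus n d, momentT π (π t v) = momentG π (π t v)) {R : ℝ} (hR : 0 < R) :
    sInf (fv π v '' ball n d R) = sInf (fv π v '' (torus n d ∩ ball n d R)) := by
  obtain ⟨H, hH, hHR, hmin⟩ := exists_flat_minimizer hrat hinv hmom hR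
  have hmem : exp H ∈ ball n d R := ⟨H, hH.1, hHR, rfl⟩
  have h1 : IsLeast (fv π v '' ball n d R) (fv π v (exp H)) :=
    ⟨Set.mem_image_of_mem _ hmem, Set.forall_mem_image.2 hmin⟩
  have h2 : IsLeast (fv π v '' (torus n d ∩ ball n d R)) (fv π v (exp H)) :=
    ⟨Set.mem_image_of_mem _ ⟨exp_mem_torus hH, hmem⟩,
      Set.forall_mem_image.2 fun g hg => hmin g hg.2⟩
  rw [h1.csInf_eq, h2.csInf_eq]

theorem sInf_norm_sq_groupBall_eq (hrat : IsRational π) (hinv : IsKInvariant π) {v : V}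
    (hmom : ∀ t ∈ torus n d, momentT π (π t v) = momentG π (π t v)) {R : ℝ} (hR : 0 < R) :
    sInf ((fun g => ‖π g v‖ ^ 2) '' groupBall n d R) =
      sInf ((fun g => ‖π g v‖ ^ 2) '' (torus n d ∩ groupBall n d R)) := by
  -- `‖π(k p) v‖ ^ 2 = f_v (p ^ 2)`, and squaring maps the ball of radius `R` to that of `2 R`.
  obtain ⟨H, hH, hHR, hmin⟩ := exists_flat_minimizer hrat hinv hmom (mul_pos two_pos hR)
  have hHh : (2⁻¹ : ℝ) • H ∈ iLieTK n d := Submodule.smul_mem _ _ hH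
  set t := exp ((2⁻¹ : ℝ) • H) with ht
  have htv : ‖π t v‖ ^ 2 = fv π v (exp H) := by
    rw [ht, norm_sq_rep_exp hrat hinv hHh.1, smul_smul, mul_inv_cancel₀ two_ne_zero, one_smul]
  have hmem : t ∈ groupBall n d R := by
    refine ⟨1, fun k => one_mem _, t, ⟨_, hHh.1, ?_, rfl⟩, (one_mul t).symm⟩
    rw [frobenius_real_smul, abs_of_pos (by norm_num)]
    linarith
  have hle : ∀ g ∈ groupBall n d R, ‖π t v‖ ^ 2 ≤ ‖π g v‖ ^ 2 := by
    rintro g ⟨k, hk, p, ⟨A, hA, hAR, rfl⟩, rfl⟩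
    have hnorm : ‖π (k * exp A) v‖ = ‖π (exp A) v‖ := by
      rw [rep_mul_apply, ← sq_eq_sq₀ (norm_nonneg _) (norm_nonneg _)]
      have h := hinv k hk (π (exp A) v) (π (exp A) v)
      rw [inner_self_eq_norm_sq_to_K, inner_self_eq_norm_sq_to_K] at h
      exact_mod_cast h
    rw [hnorm, htv, norm_sq_rep_exp hrat hinv hA]
    refine hmin _ ⟨_, Submodule.smul_mem _ (2 : ℝ) hA, ?_, rfl⟩
    rw [frobenius_real_smul, abs_of_pos two_pos]
    linarith
  have h1 : IsLeast ((fun g => ‖π g v‖ ^ 2) '' groupBall n d R) (‖π t v‖ ^ 2) :=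
    ⟨Set.mem_image_of_mem (fun g => ‖π g v‖ ^ 2) hmem, Set.forall_mem_image.2 hle⟩
  have h2 : IsLeast ((fun g => ‖π g v‖ ^ 2) '' (torus n d ∩ groupBall n d R)) (‖π t v‖ ^ 2) :=
    ⟨Set.mem_image_of_mem (fun g => ‖π g v‖ ^ 2) ⟨exp_mem_torus hHh, hmem⟩,
      Set.forall_mem_image.2 fun g hg => hle g hg.2⟩
  rw [h1.csInf_eq, h2.csInf_eq]

theorem sInf_fv_posDef_eq (hrat : IsRational π) (hinv : IsKInvariant π) {v : V}
    (hmom : ∀ t ∈ torus n d, momentT π (π t v) = momentG π (π t v)) :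
    sInf (fv π v '' posDef n d) = sInf (fv π v '' (torus n d ∩ posDef n d)) := by
  have hbdd : BddBelow (fv π v '' posDef n d) := by
    refine ⟨0, Set.forall_mem_image.2 fun p hp => ?_⟩
    obtain ⟨A, hA, rfl⟩ := exists_exp_eq_of_mem_posDef hp
    exact fv_exp_nonneg hrat hinv hA v
  have hsub : fv π v '' (torus n d ∩ posDef n d) ⊆ fv π v '' posDef n d :=
    Set.image_mono Set.inter_subset_right
  have h0 : (1 : SLPow n d) ∈ torus n d ∩ posDef n d := by
    rw [← exp_zero]
    exact ⟨exp_mem_torus (Submodule.zero_mem _), exp_mem_posDef (Submodule.zero_mem _)⟩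
  refine le_antisymm (csInf_le_csInf hbdd ⟨_, Set.mem_image_of_mem _ h0⟩ hsub)
    (le_csInf ⟨_, Set.mem_image_of_mem _ h0.2⟩ (Set.forall_mem_image.2 fun p hp => ?_))
  obtain ⟨A, hA, rfl⟩ := exists_exp_eq_of_mem_posDef hp
  obtain ⟨H, hH, -, hmin⟩ := exists_flat_minimizer hrat hinv hmom
    (by linarith [frobenius_nonneg A] : 0 < frobenius A + 1)
  exact (csInf_le (hbdd.mono hsub)
    (Set.mem_image_of_mem _ ⟨exp_mem_torus hH, exp_mem_posDef hH.1⟩)).trans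
      (hmin _ ⟨A, hA, by linarith, rfl⟩)

end Representation

end SLPow

theorem mainTheorem7 {n d : ℕ} {V : Type*} [NormedAddCommGroup V] [InnerProductSpace ℂ V]
    [FiniteDimensional ℂ V] (π : Representation ℂ (SLPow n d) V)
    (hrat : SLPow.IsRational π) (hinv : SLPow.IsKInvariant π) (v : V) (hv : v ≠ 0) :
    (SLPow.IsFree (SLPow.weightSupport π v) →
      ∀ t ∈ SLPow.torus n d, SLPow.momentT π (π t v) = SLPow.momentG π (π t v)) ∧
    ((∀ t ∈ SLPow.torus n d, SLPow.momentT π (π t v) = SLPow.momentG π (π t v)) →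
      (∀ R : ℝ, 0 < R →
        sInf (SLPow.fv π v '' SLPow.ball n d R) =
          sInf (SLPow.fv π v '' (SLPow.torus n d ∩ SLPow.ball n d R))) ∧
      (∀ R : ℝ, 0 < R →
        sInf ((fun g => ‖π g v‖ ^ 2) '' SLPow.groupBall n d R) =
          sInf ((fun g => ‖π g v‖ ^ 2) '' (SLPow.torus n d ∩ SLPow.groupBall n d R))) ∧
      (∀ ε : ℝ, 0 < ε →
        SLPow.diameterBound (SLPow.posDef n d) (SLPow.ball n d) (SLPow.fv π v) ε =
          SLPow.diameterBound (SLPow.torus n d ∩ SLPow.posDef n d)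
            (fun R => SLPow.torus n d ∩ SLPow.ball n d R) (SLPow.fv π v) ε)) := by
  refine ⟨fun hfree t ht => SLPow.momentT_eq_momentG_of_isFree hrat hinv hfree ht,
    fun hmom => ⟨fun R hR => SLPow.sInf_fv_ball_eq hrat hinv hmom hR,
      fun R hR => SLPow.sInf_norm_sq_groupBall_eq hrat hinv hmom hR, fun ε _ => ?_⟩⟩
  rw [SLPow.diameterBound, SLPow.diameterBound, SLPow.sInf_fv_posDef_eq hrat hinv hmom]
  congr 1
  ext R
  refine and_congr_right fun hR => ?_
  rw [SLPow.sInf_fv_ball_eq hrat hinv hmom hR]
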